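/- Fix a 2-category $\mathsf{Cat}$ of categories (objects and hom-sets in fixed universes). Horizontal composition of functors and natural transformations is written as juxtaposition and vertical composition as $\bullet$. A lax (co)monoidal functor is written $(G,G_2,G_0)$ (resp. $(T,T^2,T^0)$). **The 2-functor $\mathsf Q$.** Let $\mathsf{L}\text{-}\mathsf{Func}$ be the 2-category whose objects are the functors $U\colon\mathcal A\to\mathcal M$ that have a left adjoint, whose 1-cells from $U\colon\mathcal A\to\mathcal M$ to $V\colon\mathcal B\to\mathcal N$ are triples $\langle F,\kappa,G\rangle$ of functors $F\colon\mathcal A\to\mathcal B$, $G\colon\mathcal M\to\mathcal N$ and a natural isomorphism $\kappa\colon GU\to VF$, and whose 2-cells $\langle F,\kappa,G\rangle\to\langle F',\kappa',G'\rangle$ are pairs $[\vartheta,\nu]$ of natural transformations $\vartheta\colon F\to F'$, $\nu\colon G\to G'$ with $V\vartheta\bullet\kappa=\kappa'\bullet\nu U$; 1-cells compose by $\langle H,\lambda,I\rangle\langle F,\kappa,G\rangle=\langle HF,\lambda F\bullet I\kappa,IG\rangle$. Let $\mathsf{Mnd}$ be the 2-category of monads in $\mathsf{Cat}$: 1-cells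 from $(\mathcal M,R)$ to $(\mathcal N,S)$ are monad morphisms $\langle G,\varphi\rangle$, i.e. $\varphi\colon SG\to GR$ with $\varphi\bullet\mu_SG=G\mu_R\bullet\varphi R\bullet S\varphi$ and $\varphi\bullet\eta_SG=G\eta_R$; they compose by $\langle I,\chi\rangle\langle G,\varphi\rangle=\langle IG,I\varphi\bullet\chi G\rangle$; 2-cells $\langle G,\varphi\rangle\to\langle G',\varphi'\rangle$ are $\nu\colon G\to G'$ with $\nu R\bullet\varphi=\varphi'\bullet S\nu$. A natural transformation $\alpha\colon RU\to U$ (with $R\colon\mathcal M\to\mathcal M$) is called a *universal left action* on $U\colon\mathcal A\to\mathcal M$ if for every functor $V\colon\mathcal B\to\mathcal N$, every $S\colon\mathcal N\to\mathcal N$ and $\beta\colon SV\to V$, all functors $F,F'\colon\mathcal A\to\mathcal B$, $G,G'\colon\mathcal M\to\mathcal N$, all natural isomorphisms $\kappa\colon GU\to VF$, $\kappa'\colon G'U\to VF'$ and every $\vartheta\colon F\to F'$ there is a unique $\psi\colon SG\to G'R$ with $V\vartheta\bullet\beta F\bullet S\kappa=\kappa'\bullet G'\alpha\bullet\psi U$.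 (Every $U$ with a left adjoint has one.) Given a choice of a universal left action $\omega_U\colon T_UU\to U$ for each object $U$ of $\mathsf{L}\text{-}\mathsf{Func}$, let $\mathsf Q\colon\mathsf{L}\text{-}\mathsf{Func}\to\mathsf{Mnd}$ be the 2-functor defined as follows. $\mathsf Q(U)$ is the monad $\langle T_U,\mu,\eta\rangle$ on $\mathcal M$, where $\mu,\eta$ are the unique natural transformations with $\omega_U\bullet\mu U=\omega_U\bullet T_U\omega_U$ and $\omega_U\bullet\eta U=U$. $\mathsf Q\langle F,\kappa,G\rangle=\langle G,\varphi\rangle$, where $\varphi\colon T_VG\to GT_U$ is the unique solution of $\omega_VF\bullet T_V\kappa=\kappa\bullet G\omega_U\bullet\varphi U$. Finally $\mathsf Q[\vartheta,\nu]=\nu$. **The monoidal versions.** Let $\mathsf{L}\text{-}\mathsf{MFunc}$ be the 2-category whose objects are the (strong) monoidal functors $U\colon\mathcal A\to\mathcal M$ between monoidal categories whose underlying functor has a left adjoint, whose 1-cells are the triples $\langle F,\kappa,G\rangle$ as above with $F,G$ lax monoidal functors and $\kappa$ a monoidal natural isomorphism, and whose 2-cells are the pairs $[\vartheta,\nu]$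 as above with $\vartheta,\nu$ monoidal. Let $\mathsf{Bmd}$ be the 2-category whose objects are bimonads, i.e. monoidal categories $\mathcal M$ with a monad $\langle T,\mu,\eta\rangle$ and a lax comonoidal structure $T^2,T^0$ on $T$ for which $\mu$ and $\eta$ are comonoidal; whose 1-cells are the monad morphisms $\langle G,\varphi\rangle$ with $G$ lax monoidal and $\varphi\colon SG\to GR$ *ambimonoidal*, i.e. for all $x,y$ $$G_{2;Rx,Ry}\circ(\varphi_x\otimes\varphi_y)\circ S^2_{Gx,Gy}=GR^2_{x,y}\circ\varphi_{x\otimes y}\circ SG_{2;x,y},\qquad G_0\circ S^0=GR^0\circ\varphi_{i}\circ SG_0 ,$$ where $i$ is the unit object of $\mathcal M$; and whose 2-cells are the 2-cells $\nu$ of $\mathsf{Mnd}$ that are monoidal. All compositions are those of $\mathsf{L}\text{-}\mathsf{Func}$ and $\mathsf{Mnd}$. **Theorem.** Given $\mathsf Q\colon\mathsf{L}\text{-}\mathsf{Func}\to\mathsf{Mnd}$ as above, there is a unique (strict) 2-functor $\mathbb Q\colon\mathsf{L}\text{-}\mathsf{MFunc}\to\mathsf{Bmd}$ such that 1. the square formed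 by $\mathbb Q$, $\mathsf Q$ and the 2-functors $\mathsf{L}\text{-}\mathsf{MFunc}\to\mathsf{L}\text{-}\mathsf{Func}$, $\mathsf{Bmd}\to\mathsf{Mnd}$ forgetting the (co)monoidal structures commutes strictly, and 2. $\mathbb Q$ leaves the given monoidal structures on the codomain side unchanged: $\mathbb Q(U\colon\mathcal A\to\mathcal M)$ is a bimonad on the given monoidal category $\mathcal M$, and the lax monoidal functor in $\mathbb Q\langle F,\kappa,G\rangle$ is the given $(G,G_2,G_0)$. Equivalently, $\mathbb Q$ commutes with the 2-functors to the 2-category of monoidal categories, lax monoidal functors and monoidal natural transformations that send $U\colon\mathcal A\to\mathcal M$, $\langle F,\kappa,G\rangle$, $[\vartheta,\nu]$ and $(\mathcal M,T)$, $\langle G,\varphi\rangle$, $\nu$ to $\mathcal M$, $G$, $\nu$. -/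

import Mathlib

open CategoryTheory MonoidalCategory Bicategory

universe v u

namespace SzBmd

/-! ## Left-adjointable functors: the 2-category `L-Func` -/

/-- An object of `L-Func`: a functor `U : A ⥤ M` that has a left adjoint. -/
structure LFunc where
  A : Type u
  M : Type u
  [catA : Category.{v} A]
  [catM : Category.{v} M]
  U : A ⥤ M
  hasLeftAdjoint : U.IsRightAdjoint

namespace LFunc

attribute [instance] catA catM

/-- A 1-cell `⟨F, κ, G⟩` of `L-Func`; the 2-cell `κ : G U ⟶ V F` is invertible. -/
structure Hom (X Y : LFunc.{v, u}) where
  F : X.A ⥤ Y.A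
  G : X.M ⥤ Y.M
  κ : X.U ⋙ G ≅ F ⋙ Y.U

/-- A 2-cell `[ϑ, ν]` of `L-Func`, with `V ϑ • κ = κ' • ν U`. -/
@[ext]
structure Hom₂ {X Y : LFunc.{v, u}} (f g : Hom X Y) where
  θ : f.F ⟶ g.F
  ν : f.G ⟶ g.G
  w : ∀ a : X.A, f.κ.hom.app a ≫ Y.U.map (θ.app a) = ν.app (X.U.obj a) ≫ g.κ.hom.app a

@[simp]
def idHom (X : LFunc.{v, u}) : Hom X X where
  F := 𝟭 X.A
  G := 𝟭 X.M
  κ := NatIso.ofComponents (fun a => Iso.refl (X.U.obj a))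

/-- `⟨H, lam, I⟩ □ ⟨F, κ, G⟩ = ⟨H F, lam F • I κ, I G⟩`, in diagrammatic order. -/
@[simp]
def compHom {X Y Z : LFunc.{v, u}} (f : Hom X Y) (g : Hom Y Z) : Hom X Z where
  F := f.F ⋙ g.F
  G := f.G ⋙ g.G
  κ := NatIso.ofComponents
    (fun a => g.G.mapIso (f.κ.app a) ≪≫ g.κ.app (f.F.obj a))
    (by
      intro a b h
      have h1 := f.κ.hom.naturality h
      have h2 := g.κ.hom.naturality (f.F.map h)
      simp only [Functor.comp_obj, Functor.comp_map] at h1 h2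
      simp only [Functor.comp_obj, Functor.comp_map, Iso.trans_hom, Functor.mapIso_hom,
        Iso.app_hom, Category.assoc]
      rw [← h2, ← Category.assoc, ← Category.assoc, ← Functor.map_comp, ← Functor.map_comp, h1])

instance : CategoryStruct LFunc.{v, u} where
  Hom := Hom
  id := idHom
  comp := compHom

instance (X Y : LFunc.{v, u}) : Category (X ⟶ Y) where
  Hom f g := Hom₂ f g
  id f := { θ := 𝟙 f.F, ν := 𝟙 f.G, w := by simp }
  comp a b :=
    { θ := a.θ ≫ b.θ
      ν := a.ν ≫ b.ν
      w := fun x => by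
        have h1 := a.w x
        have h2 := b.w x
        simp only [NatTrans.comp_app, Functor.map_comp, Category.assoc]
        rw [← Category.assoc, h1, Category.assoc, h2] }
  id_comp _ := Hom₂.ext (Category.id_comp _) (Category.id_comp _)
  comp_id _ := Hom₂.ext (Category.comp_id _) (Category.comp_id _)
  assoc _ _ _ := Hom₂.ext (Category.assoc _ _ _) (Category.assoc _ _ _)

@[ext]
theorem hom₂_ext {X Y : LFunc.{v, u}} {f g : X ⟶ Y} {a b : f ⟶ g}
    (h1 : a.θ = b.θ) (h2 : a.ν = b.ν) : a = b := Hom₂.ext h1 h2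

section simps

variable {X Y Z : LFunc.{v, u}}

@[simp] theorem id_F : (𝟙 X : X ⟶ X).F = 𝟭 X.A := rfl
@[simp] theorem id_G : (𝟙 X : X ⟶ X).G = 𝟭 X.M := rfl
@[simp] theorem id_κ (a : X.A) : (𝟙 X : X ⟶ X).κ.hom.app a = 𝟙 (X.U.obj a) := rfl
@[simp] theorem comp_F (f : X ⟶ Y) (g : Y ⟶ Z) : (f ≫ g).F = f.F ⋙ g.F := rfl
@[simp] theorem comp_G (f : X ⟶ Y) (g : Y ⟶ Z) : (f ≫ g).G = f.G ⋙ g.G := rfl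
@[simp] theorem comp_κ (f : X ⟶ Y) (g : Y ⟶ Z) (a : X.A) :
    (f ≫ g).κ.hom.app a = g.G.map (f.κ.hom.app a) ≫ g.κ.hom.app (f.F.obj a) := rfl
@[simp] theorem id_θ (f : X ⟶ Y) : Hom₂.θ (𝟙 f) = 𝟙 f.F := rfl
@[simp] theorem id_ν (f : X ⟶ Y) : Hom₂.ν (𝟙 f) = 𝟙 f.G := rfl
@[simp] theorem comp_θ {f g h : X ⟶ Y} (a : f ⟶ g) (b : g ⟶ h) :
    (a ≫ b).θ = a.θ ≫ b.θ := rfl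
@[simp] theorem comp_ν {f g h : X ⟶ Y} (a : f ⟶ g) (b : g ⟶ h) :
    (a ≫ b).ν = a.ν ≫ b.ν := rfl

end simps

theorem hom_ext {X Y : LFunc.{v, u}} (f g : X ⟶ Y) (hF : f.F = g.F) (hG : f.G = g.G)
    (hκ : ∀ a, f.κ.hom.app a = eqToHom (by rw [hG]) ≫ g.κ.hom.app a ≫ eqToHom (by rw [hF])) :
    f = g := by
  obtain ⟨F, G, κ⟩ := f
  obtain ⟨F', G', κ'⟩ := g
  dsimp only at hF hG
  subst hF hG
  have : κ = κ' := by
    ext a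
    simpa using hκ a
  subst this
  rfl

/-- Build an invertible 2-cell of `L-Func` from its two components. -/
@[simp]
def isoMk {X Y : LFunc.{v, u}} {f g : X ⟶ Y} (θ : f.F ≅ g.F) (ν : f.G ≅ g.G)
    (w : ∀ a : X.A,
      f.κ.hom.app a ≫ Y.U.map (θ.hom.app a) = ν.hom.app (X.U.obj a) ≫ g.κ.hom.app a) :
    f ≅ g where
  hom := { θ := θ.hom, ν := ν.hom, w := w }
  inv :=
    { θ := θ.inv
      ν := ν.inv
      w := fun a => by
        have h := w a
        rw [← cancel_epi (ν.hom.app (X.U.obj a)), ← Category.assoc, ← h]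
        simp [← Functor.map_comp] }
  hom_inv_id := by ext <;> simp
  inv_hom_id := by ext <;> simp

/-- Whiskering on the side of the domain of the 1-cells. -/
@[simp]
def whiskerL {X Y Z : LFunc.{v, u}} (f : X ⟶ Y) {g h : Y ⟶ Z} (a : g ⟶ h) :
    (f ≫ g) ⟶ (f ≫ h) where
  θ := Functor.whiskerLeft f.F a.θ
  ν := Functor.whiskerLeft f.G a.ν
  w := fun x => by
    have := a.w (f.F.obj x)
    simp [this]

/-- Whiskering on the side of the codomain of the 1-cells. -/
@[simp]
def whiskerR {X Y Z : LFunc.{v, u}} {f g : X ⟶ Y} (a : f ⟶ g) (h : Y ⟶ Z) :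
    (f ≫ h) ⟶ (g ≫ h) where
  θ := Functor.whiskerRight a.θ h.F
  ν := Functor.whiskerRight a.ν h.G
  w := fun x => by
    have h1 := a.w x
    have h2 := h.κ.hom.naturality (a.θ.app x)
    simp only [Functor.comp_obj, Functor.comp_map] at h2
    simp only [comp_F, comp_G, comp_κ, Functor.whiskerRight_app, Category.assoc]
    rw [← h2, ← Category.assoc, ← Category.assoc, ← Functor.map_comp, ← Functor.map_comp, h1]

instance : Bicategory LFunc.{v, u} where
  whiskerLeft := whiskerL
  whiskerRight := whiskerR
  associator f g h := isoMk (f := (f ≫ g) ≫ h) (g := f ≫ g ≫ h)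
    (Functor.associator _ _ _) (Functor.associator _ _ _) (by simp)
  leftUnitor f := isoMk (f := 𝟙 _ ≫ f) (g := f)
    (Functor.leftUnitor _) (Functor.leftUnitor _) (by simp)
  rightUnitor f := isoMk (f := f ≫ 𝟙 _) (g := f)
    (Functor.rightUnitor _) (Functor.rightUnitor _) (by simp)

theorem eqToHom_θ {X Y : LFunc.{v, u}} {f g : X ⟶ Y} (h : f = g) (a : X.A) :
    (Hom₂.θ (eqToHom h)).app a = eqToHom (by rw [h]) := by
  subst h; rfl

theorem eqToHom_ν {X Y : LFunc.{v, u}} {f g : X ⟶ Y} (h : f = g) (a : X.M) :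
    (Hom₂.ν (eqToHom h)).app a = eqToHom (by rw [h]) := by
  subst h; rfl

instance : Bicategory.Strict LFunc.{v, u} where
  id_comp f := hom_ext _ _ rfl rfl fun a => by
    simp; exact (Category.id_comp _).symm
  comp_id f := hom_ext _ _ rfl rfl fun a => by
    simp; exact (Category.id_comp _).symm
  assoc f g h := hom_ext _ _ rfl rfl fun a => by
    simp; exact (Category.id_comp _).symm
  leftUnitor_eqToIso f := by
    ext a
    · simp only [eqToIso.hom, eqToHom_θ]; rfl
    · simp only [eqToIso.hom, eqToHom_ν]; rfl
  rightUnitor_eqToIso f := by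
    ext a
    · simp only [eqToIso.hom, eqToHom_θ]; rfl
    · simp only [eqToIso.hom, eqToHom_ν]; rfl
  associator_eqToIso f g h := by
    ext a
    · simp only [eqToIso.hom, eqToHom_θ]; rfl
    · simp only [eqToIso.hom, eqToHom_ν]; rfl

end LFunc

/-! ## Monads: the 2-category `Mnd` of monads in `Cat` -/

/-- An object of `Mnd`: a category with a monad on it. -/
structure Mnd where
  C : Type u
  [catC : Category.{v} C]
  T : Monad C

namespace Mnd

attribute [instance] catC

/-- A monad morphism `⟨G, φ⟩` from `⟨R, μ, η⟩` to `⟨S, μ, η⟩`, with `φ : S G ⟶ G R`. -/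
structure Hom (X Y : Mnd.{v, u}) where
  G : X.C ⥤ Y.C
  φ : G ⋙ Y.T.toFunctor ⟶ X.T.toFunctor ⋙ G
  mul : ∀ x : X.C, Y.T.μ.app (G.obj x) ≫ φ.app x =
    Y.T.map (φ.app x) ≫ φ.app (X.T.obj x) ≫ G.map (X.T.μ.app x)
  unit : ∀ x : X.C, Y.T.η.app (G.obj x) ≫ φ.app x = G.map (X.T.η.app x)

/-- A transformation of monad morphisms: `ν : G ⟶ G'` with `ν R • φ = φ' • S ν`. -/
@[ext]
structure Hom₂ {X Y : Mnd.{v, u}} (f g : Hom X Y) where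
  ν : f.G ⟶ g.G
  w : ∀ x : X.C, f.φ.app x ≫ ν.app (X.T.obj x) = Y.T.map (ν.app x) ≫ g.φ.app x

@[simp]
def idHom (X : Mnd.{v, u}) : Hom X X where
  G := 𝟭 X.C
  φ := { app := fun x => 𝟙 (X.T.obj x) }
  mul := by simp
  unit := by simp

/-- `⟨I, χ⟩ ⋄ ⟨G, φ⟩ = ⟨I G, I φ • χ G⟩`, in diagrammatic order. -/
@[simp]
def compHom {X Y Z : Mnd.{v, u}} (f : Hom X Y) (g : Hom Y Z) : Hom X Z where
  G := f.G ⋙ g.G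
  φ :=
    { app := fun x => g.φ.app (f.G.obj x) ≫ g.G.map (f.φ.app x)
      naturality := fun x y h => by
        have h1 := g.φ.naturality (f.G.map h)
        have h2 := f.φ.naturality h
        simp only [Functor.comp_obj, Functor.comp_map] at h1 h2
        simp only [Functor.comp_obj, Functor.comp_map, Category.assoc]
        rw [← Functor.map_comp, ← h2, Functor.map_comp, ← Category.assoc, h1, Category.assoc] }
  mul := fun x => by
    have h1 := g.mul (f.G.obj x)
    have h2 := congrArg g.G.map (f.mul x)
    have h3 := g.φ.naturality (f.φ.app x)
    simp only [Functor.comp_obj, Functor.comp_map, Functor.map_comp] at h1 h2 h3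
    simp only [Functor.comp_obj, Functor.comp_map, Functor.map_comp, Category.assoc]
    rw [← Category.assoc, h1, Category.assoc, Category.assoc, h2,
      ← Category.assoc (Z.T.map (g.G.map _)), h3, Category.assoc]
  unit := fun x => by
    have h1 := g.unit (f.G.obj x)
    have h2 := f.unit x
    simp only [Functor.comp_obj, Functor.comp_map]
    rw [← Category.assoc, h1, ← Functor.map_comp, h2]

instance : CategoryStruct Mnd.{v, u} where
  Hom := Hom
  id := idHom
  comp := compHom

instance (X Y : Mnd.{v, u}) : Category (X ⟶ Y) where
  Hom f g := Hom₂ f g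
  id f := { ν := 𝟙 f.G, w := by simp }
  comp a b :=
    { ν := a.ν ≫ b.ν
      w := fun x => by
        have h1 := a.w x
        have h2 := b.w x
        simp only [NatTrans.comp_app, Functor.map_comp, Category.assoc]
        rw [← Category.assoc, h1, Category.assoc, h2] }
  id_comp _ := Hom₂.ext (Category.id_comp _)
  comp_id _ := Hom₂.ext (Category.comp_id _)
  assoc _ _ _ := Hom₂.ext (Category.assoc _ _ _)

@[ext]
theorem hom₂_ext {X Y : Mnd.{v, u}} {f g : X ⟶ Y} {a b : f ⟶ g} (h : a.ν = b.ν) : a = b :=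
  Hom₂.ext h

section simps

variable {X Y Z : Mnd.{v, u}}

@[simp] theorem id_G : (𝟙 X : X ⟶ X).G = 𝟭 X.C := rfl
@[simp] theorem id_φ (x : X.C) : (𝟙 X : X ⟶ X).φ.app x = 𝟙 (X.T.obj x) := rfl
@[simp] theorem comp_G (f : X ⟶ Y) (g : Y ⟶ Z) : (f ≫ g).G = f.G ⋙ g.G := rfl
@[simp] theorem comp_φ (f : X ⟶ Y) (g : Y ⟶ Z) (x : X.C) :
    (f ≫ g).φ.app x = g.φ.app (f.G.obj x) ≫ g.G.map (f.φ.app x) := rfl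
@[simp] theorem id_ν (f : X ⟶ Y) : Hom₂.ν (𝟙 f) = 𝟙 f.G := rfl
@[simp] theorem comp_ν {f g h : X ⟶ Y} (a : f ⟶ g) (b : g ⟶ h) :
    (a ≫ b).ν = a.ν ≫ b.ν := rfl

end simps

theorem hom_ext {X Y : Mnd.{v, u}} (f g : X ⟶ Y) (hG : f.G = g.G)
    (hφ : ∀ x, f.φ.app x = eqToHom (by rw [hG]) ≫ g.φ.app x ≫ eqToHom (by rw [hG])) :
    f = g := by
  obtain ⟨G, φ, _, _⟩ := f
  obtain ⟨G', φ', _, _⟩ := g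
  dsimp only at hG
  subst hG
  have : φ = φ' := by
    ext a
    simpa using hφ a
  subst this
  rfl

/-- Build an invertible 2-cell of `Mnd` from its underlying natural isomorphism. -/
@[simp]
def isoMk {X Y : Mnd.{v, u}} {f g : X ⟶ Y} (ν : f.G ≅ g.G)
    (w : ∀ x : X.C, f.φ.app x ≫ ν.hom.app (X.T.obj x) = Y.T.map (ν.hom.app x) ≫ g.φ.app x) :
    f ≅ g where
  hom := { ν := ν.hom, w := w }
  inv :=
    { ν := ν.inv
      w := fun x => by
        have h := w x
        rw [← cancel_epi (Y.T.map (ν.hom.app x)), ← Category.assoc, ← h,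
          ← Category.assoc, ← Functor.map_comp]
        simp }
  hom_inv_id := by ext; simp
  inv_hom_id := by ext; simp

/-- Whiskering on the side of the domain of the 1-cells. -/
@[simp]
def whiskerL {X Y Z : Mnd.{v, u}} (f : X ⟶ Y) {g h : Y ⟶ Z} (a : g ⟶ h) :
    (f ≫ g) ⟶ (f ≫ h) where
  ν := Functor.whiskerLeft f.G a.ν
  w := fun x => by
    have h1 := a.w (f.G.obj x)
    have h2 := a.ν.naturality (f.φ.app x)
    simp only [Functor.comp_obj] at h1 h2
    simp only [comp_G, comp_φ, Functor.whiskerLeft_app, Category.assoc]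
    rw [h2, ← Category.assoc, h1, Category.assoc]

/-- Whiskering on the side of the codomain of the 1-cells. -/
@[simp]
def whiskerR {X Y Z : Mnd.{v, u}} {f g : X ⟶ Y} (a : f ⟶ g) (h : Y ⟶ Z) :
    (f ≫ h) ⟶ (g ≫ h) where
  ν := Functor.whiskerRight a.ν h.G
  w := fun x => by
    have h1 := a.w x
    have h2 := h.φ.naturality (a.ν.app x)
    simp only [Functor.comp_obj, Functor.comp_map] at h2
    simp only [comp_G, comp_φ, Functor.whiskerRight_app, Category.assoc]
    rw [← Functor.map_comp, h1, Functor.map_comp, ← Category.assoc, ← h2, Category.assoc]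

instance : Bicategory Mnd.{v, u} where
  whiskerLeft := whiskerL
  whiskerRight := whiskerR
  associator f g h := isoMk (f := (f ≫ g) ≫ h) (g := f ≫ g ≫ h)
    (Functor.associator _ _ _) (by simp)
  leftUnitor f := isoMk (f := 𝟙 _ ≫ f) (g := f) (Functor.leftUnitor _) (by simp)
  rightUnitor f := isoMk (f := f ≫ 𝟙 _) (g := f) (Functor.rightUnitor _) (by simp)

theorem eqToHom_ν {X Y : Mnd.{v, u}} {f g : X ⟶ Y} (h : f = g) (x : X.C) :
    (Hom₂.ν (eqToHom h)).app x = eqToHom (by rw [h]) := by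
  subst h; rfl

instance : Bicategory.Strict Mnd.{v, u} where
  id_comp f := hom_ext _ _ rfl fun x => by simp; exact (Category.id_comp _).symm
  comp_id f := hom_ext _ _ rfl fun x => by simp; exact (Category.id_comp _).symm
  assoc f g h := hom_ext _ _ rfl fun x => by simp; exact (Category.id_comp _).symm
  leftUnitor_eqToIso f := by ext x; simp only [eqToIso.hom, eqToHom_ν]; rfl
  rightUnitor_eqToIso f := by ext x; simp only [eqToIso.hom, eqToHom_ν]; rfl
  associator_eqToIso f g h := by ext x; simp only [eqToIso.hom, eqToHom_ν]; rfl

theorem mk_congr {X Y : Mnd.{v, u}} {G : X.C ⥤ Y.C}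
    {φ φ' : G ⋙ Y.T.toFunctor ⟶ X.T.toFunctor ⋙ G} (h : φ = φ') {h1 h2 h1' h2'} :
    (Hom.mk G φ h1 h2 : Hom X Y) = Hom.mk G φ' h1' h2' := by
  subst h; rfl

theorem eq_sandwich {X Y : Mnd.{v, u}} {f g f' g' : X ⟶ Y} (p : f = f') (q : g' = g)
    {a : f ⟶ g} {b : f' ⟶ g'}
    (h : ∀ x, a.ν.app x = eqToHom (by rw [p]) ≫ b.ν.app x ≫ eqToHom (by rw [q])) :
    a = eqToHom p ≫ b ≫ eqToHom q := by
  subst p q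
  ext x
  simpa using h x

end Mnd

/-! ## The 2-category of monoidal categories -/

/-- A monoidal category, as an object of the 2-category of monoidal categories,
lax monoidal functors and monoidal natural transformations. -/
structure LaxMonCat where
  C : Type u
  [catC : Category.{v} C]
  [monC : MonoidalCategory C]

namespace LaxMonCat

attribute [instance] catC monC

/-- A 1-cell: a lax monoidal functor. -/
structure Hom (X Y : LaxMonCat.{v, u}) where
  F : X.C ⥤ Y.C
  lax : F.LaxMonoidal

/-- A 2-cell: a monoidal natural transformation. -/
@[ext]
structure Hom₂ {X Y : LaxMonCat.{v, u}} (f g : Hom X Y) where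
  ν : f.F ⟶ g.F
  mon : @NatTrans.IsMonoidal _ _ _ _ _ _ _ _ ν f.lax g.lax

instance : CategoryStruct LaxMonCat.{v, u} where
  Hom := Hom
  id X := { F := 𝟭 X.C, lax := inferInstance }
  comp f g :=
    { F := f.F ⋙ g.F
      lax := @Functor.LaxMonoidal.comp _ _ _ _ _ _ _ _ _ f.F g.F f.lax g.lax }

instance {X Y : LaxMonCat.{v, u}} (f : X ⟶ Y) : f.F.LaxMonoidal := f.lax

instance (X Y : LaxMonCat.{v, u}) : Category (X ⟶ Y) where
  Hom f g := Hom₂ f g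
  id f := { ν := 𝟙 f.F, mon := NatTrans.IsMonoidal.id }
  comp a b :=
    { ν := a.ν ≫ b.ν
      mon :=
        have := a.mon
        have := b.mon
        NatTrans.IsMonoidal.comp a.ν b.ν }
  id_comp _ := Hom₂.ext (Category.id_comp _)
  comp_id _ := Hom₂.ext (Category.comp_id _)
  assoc _ _ _ := Hom₂.ext (Category.assoc _ _ _)

instance {X Y : LaxMonCat.{v, u}} {f g : X ⟶ Y} (a : f ⟶ g) :
    NatTrans.IsMonoidal (Hom₂.ν a) := a.mon

@[ext]
theorem hom₂_ext {X Y : LaxMonCat.{v, u}} {f g : X ⟶ Y} {a b : f ⟶ g} (h : a.ν = b.ν) :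
    a = b := Hom₂.ext h

section simps

variable {X Y Z : LaxMonCat.{v, u}}

@[simp] theorem id_F : (𝟙 X : X ⟶ X).F = 𝟭 X.C := rfl
@[simp] theorem comp_F (f : X ⟶ Y) (g : Y ⟶ Z) : (f ≫ g).F = f.F ⋙ g.F := rfl
@[simp] theorem id_ν (f : X ⟶ Y) : Hom₂.ν (𝟙 f) = 𝟙 f.F := rfl
@[simp] theorem comp_ν {f g h : X ⟶ Y} (a : f ⟶ g) (b : g ⟶ h) :
    (a ≫ b).ν = a.ν ≫ b.ν := rfl
@[simp] theorem id_ε : Functor.LaxMonoidal.ε (𝟙 X : X ⟶ X).F = 𝟙 (𝟙_ X.C) := rfl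
@[simp] theorem id_μ (x y : X.C) : Functor.LaxMonoidal.μ (𝟙 X : X ⟶ X).F x y = 𝟙 (x ⊗ y) := rfl
@[simp] theorem comp_ε (f : X ⟶ Y) (g : Y ⟶ Z) :
    Functor.LaxMonoidal.ε (f ≫ g).F = Functor.LaxMonoidal.ε g.F ≫ g.F.map (Functor.LaxMonoidal.ε f.F) := rfl
@[simp] theorem comp_μ (f : X ⟶ Y) (g : Y ⟶ Z) (x y : X.C) :
    Functor.LaxMonoidal.μ (f ≫ g).F x y =
      Functor.LaxMonoidal.μ g.F (f.F.obj x) (f.F.obj y) ≫ g.F.map (Functor.LaxMonoidal.μ f.F x y) := rfl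

end simps

theorem hom_ext {X Y : LaxMonCat.{v, u}} (f g : X ⟶ Y) (h : f.F = g.F)
    (hε : Functor.LaxMonoidal.ε f.F = Functor.LaxMonoidal.ε g.F ≫ eqToHom (by rw [h]))
    (hμ : ∀ x y, Functor.LaxMonoidal.μ f.F x y =
      eqToHom (by rw [h]) ≫ Functor.LaxMonoidal.μ g.F x y ≫ eqToHom (by rw [h])) : f = g := by
  obtain ⟨F, iF⟩ := f
  obtain ⟨G, iG⟩ := g
  dsimp only at h
  subst h
  have : iF = iG := by
    apply Functor.LaxMonoidal.ext
    · simpa using hε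
    · funext x y
      simpa using hμ x y
  subst this
  rfl

/-- Build an invertible 2-cell from a monoidal natural isomorphism. -/
@[simp]
def isoMk {X Y : LaxMonCat.{v, u}} {f g : X ⟶ Y} (ν : f.F ≅ g.F)
    (h : NatTrans.IsMonoidal ν.hom) : f ≅ g where
  hom := { ν := ν.hom, mon := h }
  inv := { ν := ν.inv, mon := inferInstanceAs (NatTrans.IsMonoidal ν.inv) }
  hom_inv_id := by ext; simp
  inv_hom_id := by ext; simp

/-- Whiskering on the side of the domain of the 1-cells. -/
@[simp]
def whiskerL {X Y Z : LaxMonCat.{v, u}} (f : X ⟶ Y) {g h : Y ⟶ Z} (a : g ⟶ h) :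
    (f ≫ g) ⟶ (f ≫ h) where
  ν := Functor.whiskerLeft f.F a.ν
  mon := NatTrans.IsMonoidal.whiskerLeft a.ν

/-- Whiskering on the side of the codomain of the 1-cells. -/
@[simp]
def whiskerR {X Y Z : LaxMonCat.{v, u}} {f g : X ⟶ Y} (a : f ⟶ g) (h : Y ⟶ Z) :
    (f ≫ h) ⟶ (g ≫ h) where
  ν := Functor.whiskerRight a.ν h.F
  mon := NatTrans.IsMonoidal.whiskerRight a.ν

instance : Bicategory LaxMonCat.{v, u} where
  whiskerLeft := whiskerL
  whiskerRight := whiskerR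
  associator f g h := isoMk (f := (f ≫ g) ≫ h) (g := f ≫ g ≫ h) (Functor.associator _ _ _)
    (inferInstanceAs (NatTrans.IsMonoidal (Functor.associator f.F g.F h.F).hom))
  leftUnitor f := isoMk (f := 𝟙 _ ≫ f) (g := f) (Functor.leftUnitor _)
    (inferInstanceAs (NatTrans.IsMonoidal (Functor.leftUnitor f.F).hom))
  rightUnitor f := isoMk (f := f ≫ 𝟙 _) (g := f) (Functor.rightUnitor _)
    (inferInstanceAs (NatTrans.IsMonoidal (Functor.rightUnitor f.F).hom))

theorem eqToHom_ν {X Y : LaxMonCat.{v, u}} {f g : X ⟶ Y} (h : f = g) (x : X.C) :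
    (Hom₂.ν (eqToHom h)).app x = eqToHom (by rw [h]) := by
  subst h; rfl

instance : Bicategory.Strict LaxMonCat.{v, u} where
  id_comp f := hom_ext _ _ rfl (by simp) (fun x y => by simp)
  comp_id f := hom_ext _ _ rfl (by simp) (fun x y => by simp)
  assoc f g h := hom_ext _ _ rfl (by simp) (fun x y => by simp)
  leftUnitor_eqToIso f := by ext x; simp only [eqToIso.hom, eqToHom_ν]; rfl
  rightUnitor_eqToIso f := by ext x; simp only [eqToIso.hom, eqToHom_ν]; rfl
  associator_eqToIso f g h := by ext x; simp only [eqToIso.hom, eqToHom_ν]; rfl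

end LaxMonCat

/-! ## Left-adjointable monoidal functors: the 2-category `L-MFunc` -/

/-- An object of `L-MFunc`: a (strong) monoidal functor `U : A ⥤ M` between monoidal categories
whose underlying functor has a left adjoint. -/
structure LMFunc where
  base : LFunc.{v, u}
  [monA : MonoidalCategory base.A]
  [monM : MonoidalCategory base.M]
  [monU : base.U.Monoidal]

namespace LMFunc

attribute [instance] monA monM monU

/-- A 1-cell `⟨F, κ, G⟩` of `L-MFunc`: a 1-cell of `L-Func` with `F` and `G` lax monoidal functors
and `κ : G U ⟶ V F` a monoidal natural isomorphism. -/
structure Hom (X Y : LMFunc.{v, u}) where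
  base : X.base ⟶ Y.base
  laxF : base.F.LaxMonoidal
  laxG : base.G.LaxMonoidal
  mon : NatTrans.IsMonoidal base.κ.hom

/-- A 2-cell `[ϑ, ν]` of `L-MFunc`: a 2-cell of `L-Func` with `ϑ` and `ν` monoidal. -/
@[ext]
structure Hom₂ {X Y : LMFunc.{v, u}} (f g : Hom X Y) where
  base : f.base ⟶ g.base
  monθ : @NatTrans.IsMonoidal _ _ _ _ _ _ _ _ base.θ f.laxF g.laxF
  monν : @NatTrans.IsMonoidal _ _ _ _ _ _ _ _ base.ν f.laxG g.laxG

section aux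

variable {A M B N C P : Type u} [Category.{v} A] [Category.{v} M] [Category.{v} B]
  [Category.{v} N] [Category.{v} C] [Category.{v} P]
  [MonoidalCategory A] [MonoidalCategory M] [MonoidalCategory B]
  [MonoidalCategory N] [MonoidalCategory C] [MonoidalCategory P]

theorem isMonoidal_idκ (U : A ⥤ M) [U.LaxMonoidal] (κ : U ⋙ 𝟭 M ⟶ 𝟭 A ⋙ U)
    (h : ∀ a, κ.app a = 𝟙 (U.obj a)) : NatTrans.IsMonoidal κ where
  unit := by rw [h]; simp
  tensor x y := by rw [h, h, h]; simp

theorem isMonoidal_compκ (U : A ⥤ M) (V : B ⥤ N) (W : C ⥤ P) (F : A ⥤ B) (G : M ⥤ N)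
    (H : B ⥤ C) (I : N ⥤ P) [U.LaxMonoidal] [V.LaxMonoidal] [W.LaxMonoidal] [F.LaxMonoidal]
    [G.LaxMonoidal] [H.LaxMonoidal] [I.LaxMonoidal] (κ : U ⋙ G ⟶ F ⋙ V) (lam : V ⋙ I ⟶ H ⋙ W)
    [NatTrans.IsMonoidal κ] [NatTrans.IsMonoidal lam] (ρ : U ⋙ G ⋙ I ⟶ (F ⋙ H) ⋙ W)
    (h : ∀ a, ρ.app a = I.map (κ.app a) ≫ lam.app (F.obj a)) : NatTrans.IsMonoidal ρ where
  unit := by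
    have h1 := congrArg I.map (NatTrans.IsMonoidal.unit (τ := κ))
    have h2 := NatTrans.IsMonoidal.unit (τ := lam)
    have h3 := lam.naturality (Functor.LaxMonoidal.ε F)
    simp only [Functor.LaxMonoidal.comp_ε, Functor.map_comp, Category.assoc, Functor.comp_map]
      at h1 h2 h3
    rw [h]
    simp only [Functor.LaxMonoidal.comp_ε, Functor.map_comp, Category.assoc, Functor.comp_map]
    rw [reassoc_of% h1, h3, reassoc_of% h2]
  tensor x y := by
    have h1 := congrArg I.map (NatTrans.IsMonoidal.tensor (τ := κ) x y)
    have h2 := NatTrans.IsMonoidal.tensor (τ := lam) (F.obj x) (F.obj y)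
    have h3 := lam.naturality (Functor.LaxMonoidal.μ F x y)
    simp only [Functor.LaxMonoidal.comp_μ, Functor.map_comp, Category.assoc, Functor.comp_map]
      at h1 h2 h3
    rw [h, h, h]
    simp only [Functor.LaxMonoidal.comp_μ, Functor.map_comp, Category.assoc, Functor.comp_map]
    rw [reassoc_of% h1, h3, ← MonoidalCategory.tensorHom_comp_tensorHom_assoc]
    dsimp only [Functor.comp_obj]
    rw [← reassoc_of% h2, Functor.LaxMonoidal.μ_natural_assoc]

end aux

@[simp]
def idHom (X : LMFunc.{v, u}) : Hom X X where
  base := 𝟙 X.base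
  laxF := inferInstanceAs (𝟭 X.base.A).LaxMonoidal
  laxG := inferInstanceAs (𝟭 X.base.M).LaxMonoidal
  mon := isMonoidal_idκ X.base.U _ fun _ => rfl

@[simp]
def compHom {X Y Z : LMFunc.{v, u}} (f : Hom X Y) (g : Hom Y Z) : Hom X Z where
  base := f.base ≫ g.base
  laxF := @Functor.LaxMonoidal.comp _ _ _ _ _ _ _ _ _ f.base.F g.base.F f.laxF g.laxF
  laxG := @Functor.LaxMonoidal.comp _ _ _ _ _ _ _ _ _ f.base.G g.base.G f.laxG g.laxG
  mon :=
    let := f.laxF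
    let := f.laxG
    let := g.laxF
    let := g.laxG
    have := f.mon
    have := g.mon
    isMonoidal_compκ X.base.U Y.base.U Z.base.U f.base.F f.base.G g.base.F g.base.G
      f.base.κ.hom g.base.κ.hom _ fun _ => rfl

instance : CategoryStruct LMFunc.{v, u} where
  Hom := Hom
  id := idHom
  comp := compHom

instance {X Y : LMFunc.{v, u}} (f : X ⟶ Y) : f.base.F.LaxMonoidal := f.laxF
instance {X Y : LMFunc.{v, u}} (f : X ⟶ Y) : f.base.G.LaxMonoidal := f.laxG

instance (X Y : LMFunc.{v, u}) : Category (X ⟶ Y) where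
  Hom f g := Hom₂ f g
  id f := { base := 𝟙 f.base, monθ := NatTrans.IsMonoidal.id, monν := NatTrans.IsMonoidal.id }
  comp a b :=
    { base := a.base ≫ b.base
      monθ :=
        have := a.monθ
        have := b.monθ
        NatTrans.IsMonoidal.comp a.base.θ b.base.θ
      monν :=
        have := a.monν
        have := b.monν
        NatTrans.IsMonoidal.comp a.base.ν b.base.ν }
  id_comp _ := Hom₂.ext (Category.id_comp _)
  comp_id _ := Hom₂.ext (Category.comp_id _)
  assoc _ _ _ := Hom₂.ext (Category.assoc _ _ _)

instance {X Y : LMFunc.{v, u}} {f g : X ⟶ Y} (a : f ⟶ g) :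
    NatTrans.IsMonoidal (Hom₂.base a).θ := a.monθ
instance {X Y : LMFunc.{v, u}} {f g : X ⟶ Y} (a : f ⟶ g) :
    NatTrans.IsMonoidal (Hom₂.base a).ν := a.monν

@[ext]
theorem hom₂_ext {X Y : LMFunc.{v, u}} {f g : X ⟶ Y} {a b : f ⟶ g} (h : a.base = b.base) :
    a = b := Hom₂.ext h

section simps

variable {X Y Z : LMFunc.{v, u}}

@[simp] theorem id_base : (𝟙 X : X ⟶ X).base = 𝟙 X.base := rfl
@[simp] theorem comp_base (f : X ⟶ Y) (g : Y ⟶ Z) : (f ≫ g).base = f.base ≫ g.base := rfl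
@[simp] theorem id_base₂ (f : X ⟶ Y) : Hom₂.base (𝟙 f) = 𝟙 f.base := rfl
@[simp] theorem comp_base₂ {f g h : X ⟶ Y} (a : f ⟶ g) (b : g ⟶ h) :
    (a ≫ b).base = a.base ≫ b.base := rfl

end simps

/-- The lax monoidal functor `F` of a 1-cell `⟨F, κ, G⟩`. -/
def domHom {X Y : LMFunc.{v, u}} (f : X ⟶ Y) :
    (LaxMonCat.mk X.base.A : LaxMonCat.{v, u}) ⟶ LaxMonCat.mk Y.base.A where
  F := f.base.F
  lax := f.laxF

/-- The lax monoidal functor `G` of a 1-cell `⟨F, κ, G⟩`. -/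
def codHom {X Y : LMFunc.{v, u}} (f : X ⟶ Y) :
    (LaxMonCat.mk X.base.M : LaxMonCat.{v, u}) ⟶ LaxMonCat.mk Y.base.M where
  F := f.base.G
  lax := f.laxG

theorem hom_ext {X Y : LMFunc.{v, u}} (f g : X ⟶ Y) (h : f.base = g.base)
    (hF : domHom f = domHom g) (hG : codHom f = codHom g) : f = g := by
  obtain ⟨f, i, j, _⟩ := f
  obtain ⟨g, i', j', _⟩ := g
  dsimp only at h
  subst h
  have h1 : i = i' := eq_of_heq (LaxMonCat.Hom.mk.inj hF).2
  have h2 : j = j' := eq_of_heq (LaxMonCat.Hom.mk.inj hG).2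
  subst h1 h2
  rfl

theorem isMonoidal_inv {C D : Type u} [Category.{v} C] [Category.{v} D] [MonoidalCategory C]
    [MonoidalCategory D] {F G : C ⥤ D} [F.LaxMonoidal] [G.LaxMonoidal] (e : F ≅ G)
    (_ : NatTrans.IsMonoidal e.hom) : NatTrans.IsMonoidal e.inv := inferInstance

theorem isMonoidal_of_inv {C D : Type u} [Category.{v} C] [Category.{v} D] [MonoidalCategory C]
    [MonoidalCategory D] {F G : C ⥤ D} [F.LaxMonoidal] [G.LaxMonoidal] (a : F ⟶ G) (b : G ⟶ F)
    (h1 : a ≫ b = 𝟙 F) (h2 : b ≫ a = 𝟙 G) [NatTrans.IsMonoidal a] : NatTrans.IsMonoidal b :=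
  isMonoidal_inv ⟨a, b, h1, h2⟩ (inferInstanceAs (NatTrans.IsMonoidal a))

/-- Build an invertible 2-cell of `L-MFunc` from an invertible 2-cell of `L-Func`. -/
@[simp]
def isoMk {X Y : LMFunc.{v, u}} {f g : X ⟶ Y} (e : f.base ≅ g.base)
    (hθ : NatTrans.IsMonoidal e.hom.θ) (hν : NatTrans.IsMonoidal e.hom.ν) : f ≅ g where
  hom := { base := e.hom, monθ := hθ, monν := hν }
  inv :=
    { base := e.inv
      monθ := isMonoidal_of_inv e.hom.θ e.inv.θ
        (congrArg LFunc.Hom₂.θ e.hom_inv_id) (congrArg LFunc.Hom₂.θ e.inv_hom_id)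
      monν := isMonoidal_of_inv e.hom.ν e.inv.ν
        (congrArg LFunc.Hom₂.ν e.hom_inv_id) (congrArg LFunc.Hom₂.ν e.inv_hom_id) }
  hom_inv_id := by ext1; simp
  inv_hom_id := by ext1; simp

/-- Whiskering on the side of the domain of the 1-cells. -/
@[simp]
def whiskerL {X Y Z : LMFunc.{v, u}} (f : X ⟶ Y) {g h : Y ⟶ Z} (a : g ⟶ h) :
    (f ≫ g) ⟶ (f ≫ h) where
  base := f.base ◁ a.base
  monθ := NatTrans.IsMonoidal.whiskerLeft (F₁ := f.base.F) a.base.θ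
  monν := NatTrans.IsMonoidal.whiskerLeft (F₁ := f.base.G) a.base.ν

/-- Whiskering on the side of the codomain of the 1-cells. -/
@[simp]
def whiskerR {X Y Z : LMFunc.{v, u}} {f g : X ⟶ Y} (a : f ⟶ g) (h : Y ⟶ Z) :
    (f ≫ h) ⟶ (g ≫ h) where
  base := a.base ▷ h.base
  monθ := NatTrans.IsMonoidal.whiskerRight (G₁ := h.base.F) a.base.θ
  monν := NatTrans.IsMonoidal.whiskerRight (G₁ := h.base.G) a.base.ν

instance : Bicategory LMFunc.{v, u} where
  whiskerLeft := whiskerL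
  whiskerRight := whiskerR
  whisker_exchange a b := hom₂_ext (Bicategory.whisker_exchange (Hom₂.base a) (Hom₂.base b))
  associator f g h := isoMk (f := (f ≫ g) ≫ h) (g := f ≫ g ≫ h) (α_ f.base g.base h.base)
    (inferInstanceAs
      (NatTrans.IsMonoidal (Functor.associator f.base.F g.base.F h.base.F).hom))
    (inferInstanceAs
      (NatTrans.IsMonoidal (Functor.associator f.base.G g.base.G h.base.G).hom))
  leftUnitor f := isoMk (f := 𝟙 _ ≫ f) (g := f) (λ_ f.base)
    (inferInstanceAs (NatTrans.IsMonoidal (Functor.leftUnitor f.base.F).hom))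
    (inferInstanceAs (NatTrans.IsMonoidal (Functor.leftUnitor f.base.G).hom))
  rightUnitor f := isoMk (f := f ≫ 𝟙 _) (g := f) (ρ_ f.base)
    (inferInstanceAs (NatTrans.IsMonoidal (Functor.rightUnitor f.base.F).hom))
    (inferInstanceAs (NatTrans.IsMonoidal (Functor.rightUnitor f.base.G).hom))

theorem eqToHom_base {X Y : LMFunc.{v, u}} {f g : X ⟶ Y} (h : f = g) :
    Hom₂.base (eqToHom h) = eqToHom (by rw [h]) := by
  subst h; rfl

instance : Bicategory.Strict LMFunc.{v, u} where
  id_comp f := hom_ext _ _ (Bicategory.Strict.id_comp (Hom.base f))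
    (Bicategory.Strict.id_comp (domHom f)) (Bicategory.Strict.id_comp (codHom f))
  comp_id f := hom_ext _ _ (Bicategory.Strict.comp_id (Hom.base f))
    (Bicategory.Strict.comp_id (domHom f)) (Bicategory.Strict.comp_id (codHom f))
  assoc f g h := hom_ext _ _ (Bicategory.Strict.assoc (Hom.base f) (Hom.base g) (Hom.base h))
    (Bicategory.Strict.assoc (domHom f) (domHom g) (domHom h))
    (Bicategory.Strict.assoc (codHom f) (codHom g) (codHom h))
  leftUnitor_eqToIso f := by
    ext1; apply hom₂_ext
    simp only [eqToIso.hom, eqToHom_base]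
    exact congrArg Iso.hom (Bicategory.Strict.leftUnitor_eqToIso (Hom.base f))
  rightUnitor_eqToIso f := by
    ext1; apply hom₂_ext
    simp only [eqToIso.hom, eqToHom_base]
    exact congrArg Iso.hom (Bicategory.Strict.rightUnitor_eqToIso (Hom.base f))
  associator_eqToIso f g h := by
    ext1; apply hom₂_ext
    simp only [eqToIso.hom, eqToHom_base]
    exact congrArg Iso.hom (Bicategory.Strict.associator_eqToIso (Hom.base f) (Hom.base g) (Hom.base h))

theorem eq_sandwich {C : Type*} [Category C] {X Y : C} (p : X = X) (q : Y = Y) {a b : X ⟶ Y}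
    (h : a = b) : a = eqToHom p ≫ b ≫ eqToHom q := by
  simp [h]

/-- The 2-functor `L-MFunc ⟶ L-Func` that forgets the monoidal structures. -/
def forget : StrictPseudofunctor LMFunc.{v, u} LFunc.{v, u} :=
  StrictPseudofunctor.mk''
    { obj := fun X => X.base
      map := fun f => Hom.base f
      map₂ := fun a => Hom₂.base a
      map₂_id := fun _ => rfl
      map₂_comp := fun _ _ => rfl
      map_id := fun _ => rfl
      map_comp := fun _ _ => rfl
      map₂_whisker_left := fun _ _ _ _ =>
        eq_sandwich rfl rfl rfl
      map₂_whisker_right := fun _ _ =>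
        eq_sandwich rfl rfl rfl }

/-- The 2-functor from `L-MFunc` to the 2-category of monoidal categories that takes a monoidal
functor `U : A ⥤ M` to its codomain `M`, `⟨F, κ, G⟩` to `G` and `[ϑ, ν]` to `ν`. -/
def cod : StrictPseudofunctor LMFunc.{v, u} LaxMonCat.{v, u} :=
  StrictPseudofunctor.mk''
    { obj := fun X => { C := X.base.M }
      map := fun f => codHom f
      map₂ := fun a => { ν := (Hom₂.base a).ν, mon := Hom₂.monν a }
      map₂_id := fun _ => rfl
      map₂_comp := fun _ _ => rfl
      map_id := fun _ => rfl
      map_comp := fun _ _ => rfl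
      map₂_whisker_left := fun {_ _ _} f {g h} a => by
        refine @eq_sandwich _ _ (codHom (f ≫ g)) (codHom (f ≫ h)) rfl rfl _ _ ?_
        rfl
      map₂_whisker_right := fun {_ _ _ f f'} a g => by
        refine @eq_sandwich _ _ (codHom (f ≫ g)) (codHom (f' ≫ g)) rfl rfl _ _ ?_
        rfl }

end LMFunc

/-! ## Bimonads: the 2-category `Bmd` -/

section comonoidal

variable {M N M' N' : Type u} [Category.{v} M] [Category.{v} N] [Category.{v} M']
  [Category.{v} N'] [MonoidalCategory M] [MonoidalCategory N] [MonoidalCategory M']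
  [MonoidalCategory N']

/-- A natural transformation between lax comonoidal functors is comonoidal if it is compatible
with the lax comonoidal structures. -/
structure IsComonoidal {R S : M ⥤ N} [R.OplaxMonoidal] [S.OplaxMonoidal] (τ : R ⟶ S) : Prop where
  counit : τ.app (𝟙_ M) ≫ Functor.OplaxMonoidal.η S = Functor.OplaxMonoidal.η R
  tensor : ∀ x y : M, τ.app (x ⊗ y) ≫ Functor.OplaxMonoidal.δ S x y =
    Functor.OplaxMonoidal.δ R x y ≫ (τ.app x ⊗ₘ τ.app y)

/-- For lax monoidal functors `G : M ⥤ N`, `H : M' ⥤ N'` and lax comonoidal functors `R : M ⥤ M'`,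
`S : N ⥤ N'`, a natural transformation `φ : S G ⟶ H R` is ambimonoidal if
`H₂ ∘ (φ ⊗ φ) ∘ S² = H R² ∘ φ ∘ S G₂` and `H₀ ∘ S⁰ = H R⁰ ∘ φ ∘ S G₀`. -/
structure IsAmbimonoidal {G : M ⥤ N} {H : M' ⥤ N'} {R : M ⥤ M'} {S : N ⥤ N'}
    [G.LaxMonoidal] [H.LaxMonoidal] [R.OplaxMonoidal] [S.OplaxMonoidal]
    (φ : G ⋙ S ⟶ R ⋙ H) : Prop where
  tensor : ∀ x y : M,
    Functor.OplaxMonoidal.δ S (G.obj x) (G.obj y) ≫ (φ.app x ⊗ₘ φ.app y) ≫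
        Functor.LaxMonoidal.μ H (R.obj x) (R.obj y) =
      S.map (Functor.LaxMonoidal.μ G x y) ≫ φ.app (x ⊗ y) ≫
        H.map (Functor.OplaxMonoidal.δ R x y)
  unit :
    Functor.OplaxMonoidal.η S ≫ Functor.LaxMonoidal.ε H =
      S.map (Functor.LaxMonoidal.ε G) ≫ φ.app (𝟙_ M) ≫ H.map (Functor.OplaxMonoidal.η R)

theorem isAmbimonoidal_id (T : M ⥤ M) [T.OplaxMonoidal] (φ : 𝟭 M ⋙ T ⟶ T ⋙ 𝟭 M)
    (h : ∀ x, φ.app x = 𝟙 (T.obj x)) : IsAmbimonoidal φ where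
  tensor x y := by rw [h, h, h]; simp
  unit := by rw [h]; simp

end comonoidal

theorem isAmbimonoidal_comp {A B C : Type u} [Category.{v} A] [Category.{v} B] [Category.{v} C]
    [MonoidalCategory A] [MonoidalCategory B] [MonoidalCategory C] (G : A ⥤ B) (H : B ⥤ C)
    (R : A ⥤ A) (S : B ⥤ B) (T : C ⥤ C) [G.LaxMonoidal] [H.LaxMonoidal] [R.OplaxMonoidal]
    [S.OplaxMonoidal] [T.OplaxMonoidal] (φ : G ⋙ S ⟶ R ⋙ G) (χ : H ⋙ T ⟶ S ⋙ H)
    (hφ : IsAmbimonoidal φ) (hχ : IsAmbimonoidal χ) (ξ : (G ⋙ H) ⋙ T ⟶ R ⋙ (G ⋙ H))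
    (h : ∀ x, ξ.app x = χ.app (G.obj x) ≫ H.map (φ.app x)) : IsAmbimonoidal ξ where
  tensor x y := by
    have h1 := hχ.tensor (G.obj x) (G.obj y)
    have h2 := congrArg H.map (hφ.tensor x y)
    have h3 := χ.naturality (Functor.LaxMonoidal.μ G x y)
    simp only [Functor.comp_obj, Functor.comp_map, Functor.map_comp] at h1 h2 h3
    rw [h, h, h]
    simp only [Functor.LaxMonoidal.comp_μ, Functor.map_comp, Category.assoc, Functor.comp_map,
      Functor.comp_obj, ← MonoidalCategory.tensorHom_comp_tensorHom]
    rw [Functor.LaxMonoidal.μ_natural_assoc, reassoc_of% h1, h2, reassoc_of% h3]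
  unit := by
    have h1 := hχ.unit
    have h2 := congrArg H.map hφ.unit
    have h3 := χ.naturality (Functor.LaxMonoidal.ε G)
    simp only [Functor.comp_obj, Functor.comp_map, Functor.map_comp] at h1 h2 h3
    rw [h]
    simp only [Functor.LaxMonoidal.comp_ε, Functor.map_comp, Category.assoc, Functor.comp_map,
      Functor.comp_obj]
    rw [reassoc_of% h1, h2, reassoc_of% h3]

/-- A bimonad: a monad `⟨T, μ, η⟩` on a monoidal category, together with a lax comonoidal
structure `T²`, `T⁰` on the functor `T` such that `μ` and `η` are comonoidal. -/
structure Bmd where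
  base : Mnd.{v, u}
  [mon : MonoidalCategory base.C]
  [oplax : base.T.toFunctor.OplaxMonoidal]
  comonμ : IsComonoidal base.T.μ
  comonη : IsComonoidal base.T.η

namespace Bmd

attribute [instance] mon oplax

/-- A 1-cell of `Bmd`: a monad morphism `⟨G, φ⟩` in which `G` is lax monoidal and `φ` is
ambimonoidal. -/
structure Hom (X Y : Bmd.{v, u}) where
  base : X.base ⟶ Y.base
  lax : base.G.LaxMonoidal
  ambi : IsAmbimonoidal base.φ

/-- A 2-cell of `Bmd`: a transformation of monad morphisms which is monoidal. -/
@[ext]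
structure Hom₂ {X Y : Bmd.{v, u}} (f g : Hom X Y) where
  base : f.base ⟶ g.base
  mon : @NatTrans.IsMonoidal _ _ _ _ _ _ _ _ base.ν f.lax g.lax

@[simp]
def idHom (X : Bmd.{v, u}) : Hom X X where
  base := 𝟙 X.base
  lax := inferInstanceAs (𝟭 X.base.C).LaxMonoidal
  ambi := isAmbimonoidal_id X.base.T.toFunctor _ fun _ => rfl

@[simp]
def compHom {X Y Z : Bmd.{v, u}} (f : Hom X Y) (g : Hom Y Z) : Hom X Z where
  base := f.base ≫ g.base
  lax := @Functor.LaxMonoidal.comp _ _ _ _ _ _ _ _ _ f.base.G g.base.G f.lax g.lax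
  ambi :=
    let := f.lax
    let := g.lax
    isAmbimonoidal_comp f.base.G g.base.G X.base.T.toFunctor Y.base.T.toFunctor
      Z.base.T.toFunctor f.base.φ g.base.φ f.ambi g.ambi _ fun _ => rfl

instance : CategoryStruct Bmd.{v, u} where
  Hom := Hom
  id := idHom
  comp := compHom

instance {X Y : Bmd.{v, u}} (f : X ⟶ Y) : f.base.G.LaxMonoidal := f.lax

instance (X Y : Bmd.{v, u}) : Category (X ⟶ Y) where
  Hom f g := Hom₂ f g
  id f := { base := 𝟙 f.base, mon := NatTrans.IsMonoidal.id }
  comp a b :=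
    { base := a.base ≫ b.base
      mon :=
        have := a.mon
        have := b.mon
        NatTrans.IsMonoidal.comp a.base.ν b.base.ν }
  id_comp _ := Hom₂.ext (Category.id_comp _)
  comp_id _ := Hom₂.ext (Category.comp_id _)
  assoc _ _ _ := Hom₂.ext (Category.assoc _ _ _)

instance {X Y : Bmd.{v, u}} {f g : X ⟶ Y} (a : f ⟶ g) :
    NatTrans.IsMonoidal (Hom₂.base a).ν := a.mon

@[ext]
theorem hom₂_ext {X Y : Bmd.{v, u}} {f g : X ⟶ Y} {a b : f ⟶ g} (h : a.base = b.base) :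
    a = b := Hom₂.ext h

section simps

variable {X Y Z : Bmd.{v, u}}

@[simp] theorem id_base : (𝟙 X : X ⟶ X).base = 𝟙 X.base := rfl
@[simp] theorem comp_base (f : X ⟶ Y) (g : Y ⟶ Z) : (f ≫ g).base = f.base ≫ g.base := rfl
@[simp] theorem id_base₂ (f : X ⟶ Y) : Hom₂.base (𝟙 f) = 𝟙 f.base := rfl
@[simp] theorem comp_base₂ {f g h : X ⟶ Y} (a : f ⟶ g) (b : g ⟶ h) :
    (a ≫ b).base = a.base ≫ b.base := rfl

end simps

/-- The lax monoidal functor `G` of a 1-cell `⟨G, φ⟩`. -/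
def laxHom {X Y : Bmd.{v, u}} (f : X ⟶ Y) :
    (LaxMonCat.mk X.base.C : LaxMonCat.{v, u}) ⟶ LaxMonCat.mk Y.base.C where
  F := f.base.G
  lax := f.lax

theorem hom_ext {X Y : Bmd.{v, u}} (f g : X ⟶ Y) (h : f.base = g.base)
    (hG : laxHom f = laxHom g) : f = g := by
  obtain ⟨f, i, _⟩ := f
  obtain ⟨g, i', _⟩ := g
  dsimp only at h
  subst h
  have h1 : i = i' := eq_of_heq (LaxMonCat.Hom.mk.inj hG).2
  subst h1
  rfl

/-- Build an invertible 2-cell of `Bmd` from an invertible 2-cell of `Mnd`. -/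
@[simp]
def isoMk {X Y : Bmd.{v, u}} {f g : X ⟶ Y} (e : f.base ≅ g.base)
    (hν : NatTrans.IsMonoidal e.hom.ν) : f ≅ g where
  hom := { base := e.hom, mon := hν }
  inv :=
    { base := e.inv
      mon := LMFunc.isMonoidal_of_inv e.hom.ν e.inv.ν
        (congrArg Mnd.Hom₂.ν e.hom_inv_id) (congrArg Mnd.Hom₂.ν e.inv_hom_id) }
  hom_inv_id := by ext1; simp
  inv_hom_id := by ext1; simp

/-- Whiskering on the side of the domain of the 1-cells. -/
@[simp]
def whiskerL {X Y Z : Bmd.{v, u}} (f : X ⟶ Y) {g h : Y ⟶ Z} (a : g ⟶ h) :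
    (f ≫ g) ⟶ (f ≫ h) where
  base := f.base ◁ a.base
  mon := NatTrans.IsMonoidal.whiskerLeft (F₁ := f.base.G) a.base.ν

/-- Whiskering on the side of the codomain of the 1-cells. -/
@[simp]
def whiskerR {X Y Z : Bmd.{v, u}} {f g : X ⟶ Y} (a : f ⟶ g) (h : Y ⟶ Z) :
    (f ≫ h) ⟶ (g ≫ h) where
  base := a.base ▷ h.base
  mon := NatTrans.IsMonoidal.whiskerRight (G₁ := h.base.G) a.base.ν

instance : Bicategory Bmd.{v, u} where
  whiskerLeft := whiskerL
  whiskerRight := whiskerR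
  whisker_exchange a b := hom₂_ext (Bicategory.whisker_exchange (Hom₂.base a) (Hom₂.base b))
  associator f g h := isoMk (f := (f ≫ g) ≫ h) (g := f ≫ g ≫ h) (α_ f.base g.base h.base)
    (inferInstanceAs
      (NatTrans.IsMonoidal (Functor.associator f.base.G g.base.G h.base.G).hom))
  leftUnitor f := isoMk (f := 𝟙 _ ≫ f) (g := f) (λ_ f.base)
    (inferInstanceAs (NatTrans.IsMonoidal (Functor.leftUnitor f.base.G).hom))
  rightUnitor f := isoMk (f := f ≫ 𝟙 _) (g := f) (ρ_ f.base)
    (inferInstanceAs (NatTrans.IsMonoidal (Functor.rightUnitor f.base.G).hom))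

theorem eqToHom_base {X Y : Bmd.{v, u}} {f g : X ⟶ Y} (h : f = g) :
    Hom₂.base (eqToHom h) = eqToHom (by rw [h]) := by
  subst h; rfl

instance : Bicategory.Strict Bmd.{v, u} where
  id_comp f := hom_ext _ _ (Bicategory.Strict.id_comp (Hom.base f))
    (Bicategory.Strict.id_comp (laxHom f))
  comp_id f := hom_ext _ _ (Bicategory.Strict.comp_id (Hom.base f))
    (Bicategory.Strict.comp_id (laxHom f))
  assoc f g h := hom_ext _ _ (Bicategory.Strict.assoc (Hom.base f) (Hom.base g) (Hom.base h))
    (Bicategory.Strict.assoc (laxHom f) (laxHom g) (laxHom h))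
  leftUnitor_eqToIso f := by
    ext1; apply hom₂_ext
    simp only [eqToIso.hom, eqToHom_base]
    exact congrArg Iso.hom (Bicategory.Strict.leftUnitor_eqToIso (Hom.base f))
  rightUnitor_eqToIso f := by
    ext1; apply hom₂_ext
    simp only [eqToIso.hom, eqToHom_base]
    exact congrArg Iso.hom (Bicategory.Strict.rightUnitor_eqToIso (Hom.base f))
  associator_eqToIso f g h := by
    ext1; apply hom₂_ext
    simp only [eqToIso.hom, eqToHom_base]
    exact congrArg Iso.hom
      (Bicategory.Strict.associator_eqToIso (Hom.base f) (Hom.base g) (Hom.base h))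

/-- The 2-functor `Bmd ⟶ Mnd` that forgets the (co)monoidal structures. -/
def forget : StrictPseudofunctor Bmd.{v, u} Mnd.{v, u} :=
  StrictPseudofunctor.mk''
    { obj := fun X => X.base
      map := fun f => Hom.base f
      map₂ := fun a => Hom₂.base a
      map₂_id := fun _ => rfl
      map₂_comp := fun _ _ => rfl
      map_id := fun _ => rfl
      map_comp := fun _ _ => rfl
      map₂_whisker_left := fun _ _ _ _ => LMFunc.eq_sandwich rfl rfl rfl
      map₂_whisker_right := fun _ _ => LMFunc.eq_sandwich rfl rfl rfl }

/-- The 2-functor from `Bmd` to the 2-category of monoidal categories that takes a bimonad on `M`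
to the monoidal category `M`, `⟨G, φ⟩` to the lax monoidal functor `G`, and `ν` to `ν`. -/
def underlying : StrictPseudofunctor Bmd.{v, u} LaxMonCat.{v, u} :=
  StrictPseudofunctor.mk''
    { obj := fun X => { C := X.base.C }
      map := fun f => laxHom f
      map₂ := fun a => { ν := (Hom₂.base a).ν, mon := Hom₂.mon a }
      map₂_id := fun _ => rfl
      map₂_comp := fun _ _ => rfl
      map_id := fun _ => rfl
      map_comp := fun _ _ => rfl
      map₂_whisker_left := fun {_ _ _} f {g h} a => by
        refine @LMFunc.eq_sandwich _ _ (laxHom (f ≫ g)) (laxHom (f ≫ h)) rfl rfl _ _ ?_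
        rfl
      map₂_whisker_right := fun {_ _ _ f f'} a g => by
        refine @LMFunc.eq_sandwich _ _ (laxHom (f ≫ g)) (laxHom (f' ≫ g)) rfl rfl _ _ ?_
        rfl }

end Bmd

/-! ## Universal left actions and the 2-functor `Q` -/

/-- A left action `α : R U ⟶ U` on a functor `U : A ⥤ M` is universal if for every left action
`β : S V ⟶ V` on a functor `V : B ⥤ N`, all `F, F' : A ⥤ B`, `G, G' : M ⥤ N`, all invertible
`κ : G U ⟶ V F`, `κ' : G' U ⟶ V F'` and every `ϑ : F ⟶ F'` there is a unique `ψ : S G ⟶ G' R` with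
`V ϑ • β F • S κ = κ' • G' α • ψ U`. -/
def IsUniversalLeftAction {A M : Type u} [Category.{v} A] [Category.{v} M] (U : A ⥤ M)
    (R : M ⥤ M) (α : U ⋙ R ⟶ U) : Prop :=
  ∀ (B N : Type u) [Category.{v} B] [Category.{v} N] (V : B ⥤ N) (S : N ⥤ N) (β : V ⋙ S ⟶ V)
    (F F' : A ⥤ B) (G G' : M ⥤ N) (κ : U ⋙ G ≅ F ⋙ V) (κ' : U ⋙ G' ≅ F' ⋙ V) (θ : F ⟶ F'),
    ∃! ψ : G ⋙ S ⟶ R ⋙ G', ∀ a : A,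
      S.map (κ.hom.app a) ≫ β.app (F.obj a) ≫ V.map (θ.app a) =
        ψ.app (U.obj a) ≫ G'.map (α.app a) ≫ κ'.hom.app a

/-- A universal left action on a functor `U : A ⥤ M`. -/
structure UniversalLeftAction {A M : Type u} [Category.{v} A] [Category.{v} M] (U : A ⥤ M) where
  R : M ⥤ M
  act : U ⋙ R ⟶ U
  universal : IsUniversalLeftAction U R act

namespace UniversalLeftAction

variable {A M : Type u} [Category.{v} A] [Category.{v} M] {U : A ⥤ M}
  (ω : UniversalLeftAction U)

/-- Universality for a single 1-cell `⟨F, κ, G⟩` and the identity of `F`. -/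
theorem existsUnique_φ {B N : Type u} [Category.{v} B] [Category.{v} N] {V : B ⥤ N}
    (S : N ⥤ N) (β : V ⋙ S ⟶ V) {F : A ⥤ B} {G : M ⥤ N} (κ : U ⋙ G ≅ F ⋙ V) :
    ∃! φ : G ⋙ S ⟶ ω.R ⋙ G, ∀ a : A,
      S.map (κ.hom.app a) ≫ β.app (F.obj a) =
        φ.app (U.obj a) ≫ G.map (ω.act.app a) ≫ κ.hom.app a := by
  have := ω.universal B N V S β F F G G κ κ (𝟙 F)
  simpa using this

theorem existsUnique_ν (S : M ⥤ M) (β : U ⋙ S ⟶ U) :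
    ∃! ν : S ⟶ ω.R, ∀ a : A, ν.app (U.obj a) ≫ ω.act.app a = β.app a := by
  have := ω.existsUnique_φ S β (F := 𝟭 A) (G := 𝟭 M)
    (NatIso.ofComponents (fun a => Iso.refl (U.obj a)))
  obtain ⟨φ, h1, h2⟩ := this
  refine ⟨φ, fun a => ?_, fun ν hν => h2 ν fun a => ?_⟩
  · have := h1 a
    simp only [NatIso.ofComponents_hom_app, Iso.refl_hom, Functor.comp_obj, Functor.id_obj] at this
    simpa using this.symm
  · have := hν a
    simp [this]

/-- Two 2-cells into `G R` agree as soon as they induce the same action. -/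
theorem uniq {N : Type u} [Category.{v} N] {G : M ⥤ N} {S : N ⥤ N}
    (ψ ψ' : G ⋙ S ⟶ ω.R ⋙ G)
    (h : ∀ a : A, ψ.app (U.obj a) ≫ G.map (ω.act.app a) =
      ψ'.app (U.obj a) ≫ G.map (ω.act.app a)) : ψ = ψ' := by
  have key := ω.existsUnique_φ (B := A) (V := U ⋙ G) S
    { app := fun a => ψ.app (U.obj a) ≫ G.map (ω.act.app a)
      naturality := fun a b f => by
        have h1 := ψ.naturality (U.map f)
        have h2 := congrArg G.map (ω.act.naturality f)
        simp only [Functor.comp_obj, Functor.comp_map, Functor.map_comp] at h1 h2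
        simp only [Functor.comp_obj, Functor.comp_map, Category.assoc]
        rw [reassoc_of% h1, h2] }
    (F := 𝟭 A) (G := G) (NatIso.ofComponents (fun a => Iso.refl (G.obj (U.obj a))))
  refine key.unique (fun a => ?_) (fun a => ?_)
  · simp
  · simp [h]

theorem uniq_id {S : M ⥤ M} (ν ν' : S ⟶ ω.R)
    (h : ∀ a : A, ν.app (U.obj a) ≫ ω.act.app a = ν'.app (U.obj a) ≫ ω.act.app a) : ν = ν' :=
  (ω.existsUnique_ν S (Functor.whiskerLeft U ν ≫ ω.act)).unique (fun _ => rfl)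
    (fun a => (h a).symm)

/-- The multiplication `μ` with `ω • μ U = ω • T ω`. -/
noncomputable def mul : ω.R ⋙ ω.R ⟶ ω.R :=
  (ω.existsUnique_ν (ω.R ⋙ ω.R)
    { app := fun a => ω.R.map (ω.act.app a) ≫ ω.act.app a
      naturality := fun a b f => by
        have h := ω.act.naturality f
        simp only [Functor.comp_map] at h
        simp only [Functor.comp_obj, Functor.comp_map, Category.assoc]
        rw [← h, ← Functor.map_comp_assoc, ← Functor.map_comp_assoc, h] }).choose

theorem mul_act (a : A) : ω.mul.app (U.obj a) ≫ ω.act.app a =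
    ω.R.map (ω.act.app a) ≫ ω.act.app a :=
  (ω.existsUnique_ν (ω.R ⋙ ω.R) _).choose_spec.1 a

/-- The unit `η` with `ω • η U = U`. -/
noncomputable def one : 𝟭 M ⟶ ω.R :=
  (ω.existsUnique_ν (𝟭 M) { app := fun a => 𝟙 (U.obj a) }).choose

theorem one_act (a : A) : ω.one.app (U.obj a) ≫ ω.act.app a = 𝟙 (U.obj a) :=
  (ω.existsUnique_ν (𝟭 M) _).choose_spec.1 a

/-- The monad `⟨T, μ, η⟩` of a universal left action. -/
noncomputable def monad : Monad M where
  toFunctor := ω.R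
  η := ω.one
  μ := ω.mul
  assoc x := by
    have h := ω.uniq_id (S := (ω.R ⋙ ω.R) ⋙ ω.R) (Functor.whiskerRight ω.mul ω.R ≫ ω.mul)
      ((Functor.associator _ _ _).hom ≫ Functor.whiskerLeft ω.R ω.mul ≫ ω.mul) (fun a => by
        have h1 := ω.mul.naturality (ω.act.app a)
        simp only [Functor.comp_map] at h1
        simp only [NatTrans.comp_app, Functor.whiskerRight_app, Functor.whiskerLeft_app,
          Functor.associator_hom_app, Category.id_comp, Category.assoc, mul_act]
        rw [← Functor.map_comp_assoc, mul_act, ← reassoc_of% h1, mul_act,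
          Functor.map_comp_assoc])
    simpa using congrArg (fun t => t.app x) h
  left_unit x := by
    have h := ω.uniq_id (Functor.whiskerLeft ω.R ω.one ≫ ω.mul) (𝟙 ω.R) (fun a => by
        have h1 := ω.one.naturality (ω.act.app a)
        simp only [Functor.id_map] at h1
        simp only [NatTrans.comp_app, Functor.whiskerLeft_app, Category.assoc, mul_act]
        rw [← reassoc_of% h1, one_act]
        simp)
    exact congrArg (fun t => t.app x) h
  right_unit x := by
    have h := ω.uniq_id (Functor.whiskerRight ω.one ω.R ≫ ω.mul) (𝟙 ω.R) (fun a => by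
        simp only [NatTrans.comp_app, Functor.whiskerRight_app, Category.assoc, mul_act]
        rw [← Functor.map_comp_assoc, one_act]
        simp)
    exact congrArg (fun t => t.app x) h

end UniversalLeftAction

section Q

variable (ω : ∀ X : LFunc.{v, u}, UniversalLeftAction X.U)

/-- `Q` on objects. -/
noncomputable abbrev Qobj (X : LFunc.{v, u}) : Mnd.{v, u} where
  C := X.M
  T := (ω X).monad

variable {X Y Z : LFunc.{v, u}}

/-- The unique `φ : S G ⟶ G R` with `β F • S κ = κ • G α • φ U`. -/
noncomputable def Qφ (f : X ⟶ Y) : f.G ⋙ (ω Y).R ⟶ (ω X).R ⋙ f.G :=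
  ((ω X).existsUnique_φ (ω Y).R (ω Y).act f.κ).choose

theorem Qφ_spec (f : X ⟶ Y) (a : X.A) :
    (ω Y).R.map (f.κ.hom.app a) ≫ (ω Y).act.app (f.F.obj a) =
      (Qφ ω f).app (X.U.obj a) ≫ f.G.map ((ω X).act.app a) ≫ f.κ.hom.app a :=
  ((ω X).existsUnique_φ (ω Y).R (ω Y).act f.κ).choose_spec.1 a

theorem Qφ_unique (f : X ⟶ Y) (φ : f.G ⋙ (ω Y).R ⟶ (ω X).R ⋙ f.G)
    (h : ∀ a : X.A, (ω Y).R.map (f.κ.hom.app a) ≫ (ω Y).act.app (f.F.obj a) =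
      φ.app (X.U.obj a) ≫ f.G.map ((ω X).act.app a) ≫ f.κ.hom.app a) : φ = Qφ ω f :=
  ((ω X).existsUnique_φ (ω Y).R (ω Y).act f.κ).unique h (Qφ_spec ω f)

/-- `Q` on 1-cells: `⟨F, κ, G⟩ ↦ ⟨G, φ⟩`. -/
noncomputable def Qmap (f : X ⟶ Y) : Qobj ω X ⟶ Qobj ω Y where
  G := f.G
  φ := Qφ ω f
  mul x := by
    have h := (ω X).uniq (G := f.G) (S := (ω Y).R ⋙ (ω Y).R)
      (Functor.whiskerLeft f.G (ω Y).mul ≫ Qφ ω f)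
      ((Functor.associator _ _ _).inv ≫ Functor.whiskerRight (Qφ ω f) (ω Y).R ≫
        (Functor.associator _ _ _).hom ≫ Functor.whiskerLeft (ω X).R (Qφ ω f) ≫
        (Functor.associator _ _ _).inv ≫ Functor.whiskerRight (ω X).mul f.G) (fun a => by
        rw [← cancel_mono (f.κ.hom.app a)]
        have h1 := Qφ_spec ω f a
        have h2 := (ω Y).mul.naturality (f.κ.hom.app a)
        have h3 := (Qφ ω f).naturality ((ω X).act.app a)
        have h4 := congrArg f.G.map ((ω X).mul_act a)
        have h5 := (ω Y).mul_act (f.F.obj a)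
        have h6 := congrArg (ω Y).R.map h1
        simp only [Functor.comp_obj, Functor.comp_map, Functor.map_comp] at h1 h2 h3 h4 h5 h6
        simp only [NatTrans.comp_app, Functor.whiskerRight_app, Functor.whiskerLeft_app,
          Functor.associator_hom_app, Functor.associator_inv_app, Category.id_comp,
          Category.assoc, Functor.comp_obj]
        rw [← h1, ← reassoc_of% h2, h5, reassoc_of% h6, reassoc_of% h4, ← reassoc_of% h3, ← h1])
    have h' := congrArg (fun t => t.app x) h
    simp only [NatTrans.comp_app, Functor.whiskerRight_app, Functor.whiskerLeft_app,
      Functor.associator_hom_app, Functor.associator_inv_app, Category.id_comp] at h'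
    exact h'
  unit x := by
    have h := (ω X).uniq (G := f.G) (S := 𝟭 Y.M)
      (Functor.whiskerLeft f.G (ω Y).one ≫ Qφ ω f)
      (Functor.whiskerRight (ω X).one f.G) (fun a => by
        rw [← cancel_mono (f.κ.hom.app a)]
        have h1 := Qφ_spec ω f a
        have h2 := (ω Y).one.naturality (f.κ.hom.app a)
        have h3 := congrArg f.G.map ((ω X).one_act a)
        have h4 := (ω Y).one_act (f.F.obj a)
        simp only [Functor.comp_obj, Functor.id_map, Functor.map_comp, Functor.id_obj,
          CategoryTheory.Functor.map_id] at h1 h2 h3 h4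
        simp only [NatTrans.comp_app, Functor.whiskerRight_app, Functor.whiskerLeft_app,
          Category.assoc, Functor.id_obj]
        rw [← h1, ← reassoc_of% h2, h4, reassoc_of% h3]
        exact Category.comp_id _)
    exact congrArg (fun t => t.app x) h

/-- `Q` on 2-cells: `[ϑ, ν] ↦ ν`. -/
noncomputable def Qmap₂ {f g : X ⟶ Y} (a : f ⟶ g) : Qmap ω f ⟶ Qmap ω g where
  ν := a.ν
  w x := by
    have h := ((ω X).universal _ _ Y.U (ω Y).R (ω Y).act f.F g.F f.G g.G f.κ g.κ a.θ).unique
      (y₁ := Qφ ω f ≫ Functor.whiskerLeft (ω X).R a.ν)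
      (y₂ := Functor.whiskerRight a.ν (ω Y).R ≫ Qφ ω g) (fun x => by
        have h1 := Qφ_spec ω f x
        have h2 := a.w x
        have h3 := a.ν.naturality ((ω X).act.app x)
        simp only [Functor.comp_obj, NatTrans.comp_app, Functor.whiskerLeft_app,
          Category.assoc] at h1 h2 h3 ⊢
        rw [← reassoc_of% h3, ← h2, reassoc_of% h1]) (fun x => by
        have h1 := Qφ_spec ω g x
        have h2 := congrArg (ω Y).R.map (a.w x)
        have h3 := (ω Y).act.naturality (a.θ.app x)
        simp only [Functor.comp_obj, NatTrans.comp_app, Functor.whiskerRight_app,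
          Functor.map_comp, Functor.comp_map, Category.assoc] at h1 h2 h3 ⊢
        rw [← h1, ← h3, reassoc_of% h2])
    exact congrArg (fun t => t.app x) h

theorem Qmap_id (X : LFunc.{v, u}) : Qmap ω (𝟙 X) = 𝟙 (Qobj ω X) := by
  have h := Qφ_unique ω (𝟙 X) (𝟙 (ω X).R) (fun a => by simp)
  exact Mnd.mk_congr h.symm

theorem Qmap_comp (f : X ⟶ Y) (g : Y ⟶ Z) : Qmap ω (f ≫ g) = Qmap ω f ≫ Qmap ω g := by
  have h := Qφ_unique ω (f ≫ g) (Qmap ω f ≫ Qmap ω g).φ (fun a => by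
    have h1 := Qφ_spec ω f a
    have h2 := Qφ_spec ω g (f.F.obj a)
    have h3 := (Qφ ω g).naturality (f.κ.hom.app a)
    have h4 := congrArg g.G.map h1
    simp only [Functor.comp_obj, Functor.comp_map, Functor.map_comp] at h1 h2 h3 h4
    simp only [LFunc.comp_κ, LFunc.comp_F, LFunc.comp_G, Functor.comp_obj, Functor.comp_map,
      Functor.map_comp, Category.assoc, Mnd.comp_φ, Qmap]
    rw [h2, reassoc_of% h3, reassoc_of% h4]
    exact (Category.assoc _ _ _).symm)
  exact Mnd.mk_congr h.symm

/-- The 2-functor `Q : L-Func ⟶ Mnd` determined by a choice of a universal left action on each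
left-adjointable functor. -/
noncomputable def Q : StrictPseudofunctor LFunc.{v, u} Mnd.{v, u} :=
  StrictPseudofunctor.mk''
    { obj := Qobj ω
      map := Qmap ω
      map₂ := Qmap₂ ω
      map₂_id := fun _ => rfl
      map₂_comp := fun _ _ => rfl
      map_id := Qmap_id ω
      map_comp := Qmap_comp ω
      map₂_whisker_left := fun _ _ _ _ =>
        Mnd.eq_sandwich _ _ fun _ => LMFunc.eq_sandwich rfl rfl rfl
      map₂_whisker_right := fun _ _ =>
        Mnd.eq_sandwich _ _ fun _ => LMFunc.eq_sandwich rfl rfl rfl }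

end Q

end SzBmd

/-!
A universal left action `ω : T U ⟶ U` on a right adjoint `U` with left adjoint `L` is, up to a unique
isomorphism, the action `U ε : U L U ⟶ U` of the monad `U L` (`UniversalLeftAction.isIso_toMonad`).
Hence a natural family `P x y ⟶ G (T x ⊗ T y)` is determined by its composites with `G (ω ⊗ ω)` at
objects `U a`, `U b` (`UniversalLeftAction.tensor_hom_ext`). In particular, for monoidal `U` the
functor `T` has exactly one lax comonoidal structure compatible with `ω` in the sense of
`IsComonoidalAction`: it exists because `U L` is lax comonoidal, `L` being so by doctrinal adjunction
and `U` being strong, and it is unique by the extensionality principle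
(`UniversalLeftAction.oplaxMonoidal_unique`). The same principle shows that `μ` and `η` are comonoidal
and that the mate `φ` of a monoidal `κ` is ambimonoidal (`isAmbimonoidal_Qφ`), which gives the lift
`bimonadFunctor`.

For uniqueness, the underlying monads, the lax monoidal functors and the 2-cells of a lift are
prescribed, so only the lax comonoidal structures are to be compared. The 1-cell `⟨A, id, U⟩` from
the identity functor of `A` to `U : A ⥤ M` is sent to some `⟨U, φ⟩` with `φ` ambimonoidal, and `ω` is
`φ` followed by `U` of the action on the identity functor. The monad of the latter is the identity
monad, with unit an invertible comonoidal transformation. It follows that `ω` is compatible with the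
comonoidal structure of the lift (`isComonoidalAction_of_isAmbimonoidal`), which therefore is the
constructed one.
-/

namespace SzBmd

open Functor.LaxMonoidal Functor.OplaxMonoidal

/-! ### Lax comonoidal structures on isomorphic functors -/

/-- The lax comonoidal structure transported along an isomorphism of functors. -/
@[reducible]
def oplaxMonoidalOfIso {C D : Type u} [Category.{v} C] [Category.{v} D] [MonoidalCategory C]
    [MonoidalCategory D] {F G : C ⥤ D} [F.OplaxMonoidal] (e : G ≅ F) : G.OplaxMonoidal where
  η := e.hom.app (𝟙_ C) ≫ η F
  δ x y := e.hom.app (x ⊗ y) ≫ δ F x y ≫ (e.inv.app x ⊗ₘ e.inv.app y)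
  δ_natural_left {x y} f z := by
    have h := e.inv.naturality f
    have h' := δ_natural F f (𝟙 z)
    simp only [CategoryTheory.Functor.map_id] at h'
    simp only [← tensorHom_id, Category.assoc, tensorHom_comp_tensorHom, Category.comp_id]
    rw [e.hom.naturality_assoc, ← reassoc_of% h', tensorHom_comp_tensorHom, h, Category.id_comp]
  δ_natural_right {x y} z f := by
    have h := e.inv.naturality f
    have h' := δ_natural F (𝟙 z) f
    simp only [CategoryTheory.Functor.map_id] at h'
    simp only [← id_tensorHom, Category.assoc, tensorHom_comp_tensorHom, Category.comp_id]
    rw [e.hom.naturality_assoc, ← reassoc_of% h', tensorHom_comp_tensorHom, h, Category.id_comp]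
  oplax_associativity x y z := by
    have h1 : (e.inv.app (x ⊗ y) ⊗ₘ e.inv.app z) ≫
        (e.hom.app (x ⊗ y) ≫ δ F x y ≫ (e.inv.app x ⊗ₘ e.inv.app y)) ▷ G.obj z =
        δ F x y ▷ F.obj z ≫ ((e.inv.app x ⊗ₘ e.inv.app y) ⊗ₘ e.inv.app z) := by
      simp only [← tensorHom_id, tensorHom_comp_tensorHom, Category.id_comp, Category.comp_id,
        Iso.inv_hom_id_app_assoc]
    have h2 : (e.inv.app x ⊗ₘ e.inv.app (y ⊗ z)) ≫
        G.obj x ◁ (e.hom.app (y ⊗ z) ≫ δ F y z ≫ (e.inv.app y ⊗ₘ e.inv.app z)) =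
        F.obj x ◁ δ F y z ≫ (e.inv.app x ⊗ₘ (e.inv.app y ⊗ₘ e.inv.app z)) := by
      simp [← id_tensorHom]
    simp only [Category.assoc]
    rw [reassoc_of% h1, h2, e.hom.naturality_assoc, associator_naturality,
      Functor.OplaxMonoidal.associativity_assoc]
  oplax_left_unitality x := by
    have h : (e.inv.app (𝟙_ C) ⊗ₘ e.inv.app x) ≫ (e.hom.app (𝟙_ C) ≫ η F) ▷ G.obj x =
        η F ▷ F.obj x ≫ 𝟙_ D ◁ e.inv.app x := by
      simp [← tensorHom_id, ← id_tensorHom]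
    simp only [Category.assoc]
    rw [h, e.hom.naturality_assoc, ← Functor.OplaxMonoidal.left_unitality_assoc,
      ← MonoidalCategory.leftUnitor_inv_naturality]
    simp
  oplax_right_unitality x := by
    have h : (e.inv.app x ⊗ₘ e.inv.app (𝟙_ C)) ≫ G.obj x ◁ (e.hom.app (𝟙_ C) ≫ η F) =
        F.obj x ◁ η F ≫ e.inv.app x ▷ 𝟙_ D := by
      simp [← tensorHom_id, ← id_tensorHom]
    simp only [Category.assoc]
    rw [h, e.hom.naturality_assoc, ← Functor.OplaxMonoidal.right_unitality_assoc,
      ← MonoidalCategory.rightUnitor_inv_naturality]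
    simp

/-! ### Universal left actions and left adjoints -/

namespace UniversalLeftAction

section adjunction

variable {A M : Type u} [Category.{v} A] [Category.{v} M] {U : A ⥤ M} {L : M ⥤ A}
  (ω : UniversalLeftAction U) (adj : L ⊣ U)

/-- The comparison `T ⟶ U L` whose component at `x` is `ω ∘ T η : T x ⟶ T U L x ⟶ U L x`. -/
def toMonad : ω.R ⟶ L ⋙ U where
  app x := ω.R.map (adj.unit.app x) ≫ ω.act.app (L.obj x)
  naturality x y f := by
    have h1 := adj.unit.naturality f
    have h2 := ω.act.naturality (L.map f)
    simp only [Functor.comp_map, Functor.id_map] at h1 h2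
    simp only [Functor.comp_map, Category.assoc]
    rw [← h2, ← Functor.map_comp_assoc, ← Functor.map_comp_assoc, h1]

theorem toMonad_counit (a : A) :
    (ω.toMonad adj).app (U.obj a) ≫ U.map (adj.counit.app a) = ω.act.app a := by
  have h := ω.act.naturality (adj.counit.app a)
  simp only [Functor.comp_map, Functor.comp_obj, Functor.id_obj] at h
  simp only [toMonad, Category.assoc]
  rw [← h, ← Functor.map_comp_assoc]
  simp

/-- A universal left action on `U` is the free-forgetful monad `U L` with its counit action. -/
theorem isIso_toMonad : IsIso (ω.toMonad adj) := by
  obtain ⟨ν, hν, -⟩ := ω.existsUnique_ν (L ⋙ U) (Functor.whiskerRight adj.counit U)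
  dsimp only [Functor.whiskerRight_app, Functor.comp_obj, Functor.id_obj] at hν
  -- The inverse is the transformation `ν` into `T` that induces the action `U ε` of `U L` on `U`.
  refine ⟨ν, ω.uniq_id _ _ fun a => ?_, ?_⟩
  · simp only [NatTrans.comp_app, Category.assoc, NatTrans.id_app]
    erw [hν, toMonad_counit, Category.id_comp]
  · ext x
    have h := ν.naturality (adj.unit.app x)
    simp only [Functor.comp_map, Functor.id_obj, Functor.comp_obj] at h
    simp only [NatTrans.comp_app, toMonad, NatTrans.id_app]
    erw [← reassoc_of% h, hν, ← Functor.map_comp]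
    simp

/-- The comparison `toMonad` as an isomorphism. -/
noncomputable def isoMonad : ω.R ≅ L ⋙ U :=
  have := ω.isIso_toMonad adj
  asIso (ω.toMonad adj)

theorem isoMonad_hom_counit (a : A) :
    (ω.isoMonad adj).hom.app (U.obj a) ≫ U.map (adj.counit.app a) = ω.act.app a :=
  ω.toMonad_counit adj a

theorem isoMonad_inv_act (a : A) :
    (ω.isoMonad adj).inv.app (U.obj a) ≫ ω.act.app a = U.map (adj.counit.app a) := by
  rw [← isoMonad_hom_counit ω adj]
  exact (ω.isoMonad adj).inv_hom_id_app_assoc _ _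

/-- A family of morphisms `P x y ⟶ G (T x ⊗ T y)`, natural with respect to some action `p` of pairs
of morphisms on `P`, is determined by the composites of its members at `U a`, `U b` with
`G (ω ⊗ ω)`: the component at `x`, `y` is recovered from `a = L x`, `b = L y`. -/
theorem tensor_hom_ext [U.IsRightAdjoint] [MonoidalCategory M] {N : Type u} [Category.{v} N]
    (G : M ⥤ N) (P : M → M → N)
    (p : ∀ {x x' y y' : M}, (x ⟶ x') → (y ⟶ y') → (P x y ⟶ P x' y'))
    (f g : ∀ x y, P x y ⟶ G.obj (ω.R.obj x ⊗ ω.R.obj y))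
    (hf : ∀ {x x' y y'} (h : x ⟶ x') (k : y ⟶ y'),
      p h k ≫ f x' y' = f x y ≫ G.map (ω.R.map h ⊗ₘ ω.R.map k))
    (hg : ∀ {x x' y y'} (h : x ⟶ x') (k : y ⟶ y'),
      p h k ≫ g x' y' = g x y ≫ G.map (ω.R.map h ⊗ₘ ω.R.map k))
    (h : ∀ a b, f (U.obj a) (U.obj b) ≫ G.map (ω.act.app a ⊗ₘ ω.act.app b) =
      g (U.obj a) (U.obj b) ≫ G.map (ω.act.app a ⊗ₘ ω.act.app b)) (x y : M) :
    f x y = g x y := by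
  let adj := Adjunction.ofIsRightAdjoint U
  have := ω.isIso_toMonad adj
  -- Composing with the invertible `T x ⟶ U L x` moves the units into `P`, by naturality.
  rw [← cancel_mono (G.map ((ω.toMonad adj).app x ⊗ₘ (ω.toMonad adj).app y))]
  simp only [toMonad, ← tensorHom_comp_tensorHom, Functor.map_comp]
  erw [← reassoc_of% hf, ← reassoc_of% hg, h]
  rfl

end adjunction

end UniversalLeftAction

end SzBmd

namespace SzBmd

open Functor.LaxMonoidal Functor.OplaxMonoidal

/-! ### The comonoidal structure of a universal left action -/

section comonoidalAction

variable {A M : Type u} [Category.{v} A] [Category.{v} M] [MonoidalCategory A]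
  [MonoidalCategory M]

/-- Compatibility of a left action `α : T U ⟶ U` on a lax monoidal functor `U` with a lax
comonoidal structure on `T`: the two composites `T (U a ⊗ U b) ⟶ U (a ⊗ b)` of the action with the
structures agree, and so do the two composites from `T` of the unit to `U` of the unit. If `T` is a
bimonad and `α` makes every `U a` a `T`-module, this says that `U₂` and `U₀` are morphisms of
modules. -/
structure IsComonoidalAction {U : A ⥤ M} {T : M ⥤ M} [U.LaxMonoidal] [T.OplaxMonoidal]
    (α : U ⋙ T ⟶ U) : Prop where
  tensor : ∀ a b : A, δ T (U.obj a) (U.obj b) ≫ (α.app a ⊗ₘ α.app b) ≫ μ U a b =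
    T.map (μ U a b) ≫ α.app (a ⊗ b)
  unit : η T ≫ Functor.LaxMonoidal.ε U = T.map (Functor.LaxMonoidal.ε U) ≫ α.app (𝟙_ A)

namespace UniversalLeftAction

variable {U : A ⥤ M} (ω : UniversalLeftAction U) [U.Monoidal]

/-- The lax comonoidal structure on `T`, transported from the composite `U L` with the left adjoint
`L`, which is lax comonoidal because `U` is lax monoidal. -/
@[reducible]
noncomputable def oplaxMonoidal [U.IsRightAdjoint] : ω.R.OplaxMonoidal :=
  let adj := Adjunction.ofIsRightAdjoint U
  letI := adj.leftAdjointOplaxMonoidal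
  oplaxMonoidalOfIso (ω.isoMonad adj)

theorem isComonoidalAction_oplaxMonoidal [U.IsRightAdjoint] :
    letI := ω.oplaxMonoidal
    IsComonoidalAction ω.act := by
  let adj := Adjunction.ofIsRightAdjoint U
  let := adj.leftAdjointOplaxMonoidal
  let := ω.oplaxMonoidal
  have hδ (x y : M) : δ ω.R x y = (ω.isoMonad adj).hom.app (x ⊗ y) ≫
      (U.map (δ U.leftAdjoint x y) ≫ δ U _ _) ≫
      ((ω.isoMonad adj).inv.app x ⊗ₘ (ω.isoMonad adj).inv.app y) := rfl
  have hη : η ω.R = (ω.isoMonad adj).hom.app (𝟙_ M) ≫ U.map (η U.leftAdjoint) ≫ η U := rfl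
  constructor
  · intro a b
    have h1 := adj.map_μ_comp_counit_app_tensor a b
    have h2 := (ω.isoMonad adj).hom.naturality (μ U a b)
    have h3 := δ_natural U (adj.counit.app a) (adj.counit.app b)
    dsimp only [Functor.comp_obj, Functor.comp_map, Functor.id_obj] at h1 h2 h3
    rw [hδ, ← ω.isoMonad_hom_counit adj (a ⊗ b), reassoc_of% h2, ← Functor.map_comp, h1]
    simp only [Category.assoc, Functor.map_comp]
    rw [tensorHom_comp_tensorHom_assoc, isoMonad_inv_act, isoMonad_inv_act]
    erw [reassoc_of% h3, Functor.Monoidal.δ_μ, Category.comp_id]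
  · have h1 := adj.map_ε_comp_counit_app_unit
    have h2 := (ω.isoMonad adj).hom.naturality (Functor.LaxMonoidal.ε U)
    dsimp only [Functor.comp_obj, Functor.comp_map, Functor.id_obj] at h1 h2
    rw [hη, ← ω.isoMonad_hom_counit adj (𝟙_ A), reassoc_of% h2, ← Functor.map_comp, h1]
    simp

/-- A universal left action on a monoidal right adjoint is compatible with at most one lax
comonoidal structure. -/
theorem oplaxMonoidal_unique [U.IsRightAdjoint] (o o' : ω.R.OplaxMonoidal)
    (h : @IsComonoidalAction _ _ _ _ _ _ _ _ _ o ω.act)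
    (h' : @IsComonoidalAction _ _ _ _ _ _ _ _ _ o' ω.act) : o = o' := by
  obtain ⟨ht, hu⟩ := h
  obtain ⟨ht', hu'⟩ := h'
  apply Functor.OplaxMonoidal.ext
  · rw [← cancel_mono (Functor.LaxMonoidal.ε U)]
    exact hu.trans hu'.symm
  · funext x y
    refine ω.tensor_hom_ext (𝟭 M) (fun x y => ω.R.obj (x ⊗ y)) (fun h k => ω.R.map (h ⊗ₘ k))
      o.δ o'.δ (fun _ _ => (@δ_natural _ _ _ _ _ _ _ o _ _ _ _ _ _).symm)
      (fun _ _ => (@δ_natural _ _ _ _ _ _ _ o' _ _ _ _ _ _).symm)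
      (fun a b => ?_) x y
    rw [← cancel_mono (μ U a b)]
    simpa using (ht a b).trans (ht' a b).symm

section bimonad

variable [ω.R.OplaxMonoidal] (h : IsComonoidalAction ω.act)
include h

theorem isComonoidal_mul [U.IsRightAdjoint] : IsComonoidal ω.mul where
  counit := by
    rw [← cancel_mono (Functor.LaxMonoidal.ε U)]
    have h1 := ω.mul.naturality (Functor.LaxMonoidal.ε U)
    have h2 := congrArg ω.R.map h.unit
    simp only [Functor.comp_map, Functor.map_comp] at h1 h2
    simp only [comp_η, Category.assoc]
    rw [h.unit, ← reassoc_of% h1, mul_act, reassoc_of% h2]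
  tensor x y := by
    refine ω.tensor_hom_ext (𝟭 M) (fun x y => ω.R.obj (ω.R.obj (x ⊗ y)))
      (fun h k => ω.R.map (ω.R.map (h ⊗ₘ k)))
      (fun x y => ω.mul.app (x ⊗ y) ≫ δ ω.R x y)
      (fun x y => δ (ω.R ⋙ ω.R) x y ≫ (ω.mul.app x ⊗ₘ ω.mul.app y)) (fun f g => ?_)
      (fun f g => ?_) (fun a b => ?_) x y
    · have h1 := ω.mul.naturality (f ⊗ₘ g)
      simp only [Functor.comp_map] at h1
      simp [reassoc_of% h1]
    · have h1 := ω.mul.naturality f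
      have h2 := ω.mul.naturality g
      have h3 := δ_natural (ω.R ⋙ ω.R) f g
      simp only [Functor.comp_map] at h1 h2 h3
      simp only [Functor.id_map, Category.assoc, tensorHom_comp_tensorHom, ← h1, ← h2]
      rw [← reassoc_of% h3, tensorHom_comp_tensorHom]
    · rw [← cancel_mono (μ U a b)]
      have h1 := ω.mul.naturality (μ U a b)
      have h2 := congrArg ω.R.map (h.tensor a b)
      simp only [Functor.comp_map, Functor.map_comp] at h1 h2
      simp only [Functor.id_map, Category.assoc, comp_δ]
      rw [h.tensor, ← reassoc_of% h1, mul_act, ← reassoc_of% h2, ← h.tensor,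
        tensorHom_comp_tensorHom_assoc, mul_act, mul_act, ← δ_natural_assoc,
        tensorHom_comp_tensorHom_assoc]

theorem isComonoidal_one [U.IsRightAdjoint] : IsComonoidal ω.one where
  counit := by
    rw [← cancel_mono (Functor.LaxMonoidal.ε U)]
    have h1 := ω.one.naturality (Functor.LaxMonoidal.ε U)
    simp only [Functor.id_map] at h1
    rw [Category.assoc, h.unit, ← reassoc_of% h1, one_act]
    simp
  tensor x y := by
    refine ω.tensor_hom_ext (𝟭 M) (fun x y => x ⊗ y) (fun h k => h ⊗ₘ k)
      (fun x y => ω.one.app (x ⊗ y) ≫ δ ω.R x y)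
      (fun x y => δ (𝟭 M) x y ≫ (ω.one.app x ⊗ₘ ω.one.app y)) (fun f g => ?_)
      (fun f g => ?_) (fun a b => ?_) x y
    · have h1 := ω.one.naturality (f ⊗ₘ g)
      simp only [Functor.id_map] at h1
      simp [reassoc_of% h1]
    · have h1 := ω.one.naturality f
      have h2 := ω.one.naturality g
      simp only [Functor.id_map] at h1 h2
      simp [tensorHom_comp_tensorHom, ← h1, ← h2]
    · rw [← cancel_mono (μ U a b)]
      have h1 := ω.one.naturality (μ U a b)
      simp only [Functor.id_map] at h1
      simp only [Functor.id_map, Category.assoc, id_δ]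
      rw [h.tensor, ← reassoc_of% h1, one_act, tensorHom_comp_tensorHom_assoc, one_act, one_act]
      simp

end bimonad

end UniversalLeftAction

end comonoidalAction

/-- The mate `φ` of a monoidal `κ` is ambimonoidal. -/
theorem isAmbimonoidal_Qφ (ω : ∀ X : LFunc.{v, u}, UniversalLeftAction X.U) {X Y : LMFunc.{v, u}}
    (f : X ⟶ Y) [(ω X.base).R.OplaxMonoidal] [(ω Y.base).R.OplaxMonoidal]
    (hX : IsComonoidalAction (ω X.base).act) (hY : IsComonoidalAction (ω Y.base).act) :
    IsAmbimonoidal (Qφ ω f.base) where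
  tensor x y := by
    have := X.base.hasLeftAdjoint
    have := f.mon
    refine (ω X.base).tensor_hom_ext f.base.G
      (fun x y => (ω Y.base).R.obj (f.base.G.obj x ⊗ f.base.G.obj y))
      (fun h k => (ω Y.base).R.map (f.base.G.map h ⊗ₘ f.base.G.map k))
      (fun x y => δ (ω Y.base).R (f.base.G.obj x) (f.base.G.obj y) ≫
        ((Qφ ω f.base).app x ⊗ₘ (Qφ ω f.base).app y) ≫ μ f.base.G _ _)
      (fun x y => (ω Y.base).R.map (μ f.base.G x y) ≫ (Qφ ω f.base).app (x ⊗ y) ≫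
        f.base.G.map (δ (ω X.base).R x y)) (fun {x x' y y'} h k => ?_)
      (fun {x x' y y'} h k => ?_) (fun a b => ?_) x y
    · have h1 := (Qφ ω f.base).naturality h
      have h2 := (Qφ ω f.base).naturality k
      simp only [Functor.comp_map, Functor.comp_obj] at h1 h2
      rw [← δ_natural_assoc, tensorHom_comp_tensorHom_assoc, h1, h2]
      simp only [Category.assoc, ← μ_natural, ← tensorHom_comp_tensorHom]
    · have h1 := (Qφ ω f.base).naturality (h ⊗ₘ k)
      simp only [Functor.comp_map, Functor.comp_obj] at h1
      simp only [Category.assoc]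
      rw [← Functor.map_comp_assoc, μ_natural, Functor.map_comp_assoc, reassoc_of% h1,
        ← Functor.map_comp, ← Functor.map_comp, δ_natural]
    · rw [← cancel_mono (f.base.G.map (μ X.base.U a b) ≫ f.base.κ.hom.app (a ⊗ b))]
      have h1 := congrArg f.base.G.map (hX.tensor a b)
      have h2 := (Qφ ω f.base).naturality (μ X.base.U a b)
      have h3 := Qφ_spec ω f.base (a ⊗ b)
      have h4 := congrArg (ω Y.base).R.map (NatTrans.IsMonoidal.tensor (τ := f.base.κ.hom) a b)
      have h5 := NatTrans.IsMonoidal.tensor (τ := f.base.κ.hom) a b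
      have h6 := (ω Y.base).act.naturality (μ f.base.F a b)
      have h7 := hY.tensor (f.base.F.obj a) (f.base.F.obj b)
      have h8 := Qφ_spec ω f.base a
      have h9 := Qφ_spec ω f.base b
      simp only [Functor.comp_map, Functor.comp_obj, Functor.map_comp, comp_μ, Category.assoc]
        at h1 h2 h3 h4 h5 h6 h7 h8 h9
      simp only [Category.assoc]
      rw [reassoc_of% h1, ← reassoc_of% h2, ← h3, reassoc_of% h4, h6, ← reassoc_of% h7,
        ← μ_natural_assoc, h5, tensorHom_comp_tensorHom_assoc, tensorHom_comp_tensorHom_assoc,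
        Category.assoc, Category.assoc, ← h8, ← h9, ← δ_natural_assoc,
        tensorHom_comp_tensorHom_assoc]
  unit := by
    have := f.mon
    rw [← cancel_mono (f.base.G.map (Functor.LaxMonoidal.ε X.base.U) ≫
      f.base.κ.hom.app (𝟙_ X.base.A))]
    have h1 := congrArg f.base.G.map hX.unit
    have h2 := (Qφ ω f.base).naturality (Functor.LaxMonoidal.ε X.base.U)
    have h3 := Qφ_spec ω f.base (𝟙_ X.base.A)
    have h4 := congrArg (ω Y.base).R.map (NatTrans.IsMonoidal.unit (τ := f.base.κ.hom))
    have h5 := NatTrans.IsMonoidal.unit (τ := f.base.κ.hom)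
    have h6 := (ω Y.base).act.naturality (Functor.LaxMonoidal.ε f.base.F)
    have h7 := hY.unit
    simp only [Functor.comp_map, Functor.comp_obj, Functor.map_comp, comp_ε, Category.assoc]
      at h1 h2 h3 h4 h5 h6 h7
    simp only [Category.assoc]
    rw [reassoc_of% h1, ← reassoc_of% h2, ← h3, reassoc_of% h4, h6, ← reassoc_of% h7, h5]

end SzBmd

namespace SzBmd

open Functor.LaxMonoidal Functor.OplaxMonoidal

section lift

variable (ω : ∀ X : LFunc.{v, u}, UniversalLeftAction X.U)

/-! ### The lift of `Q` to monoidal functors and bimonads -/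

/-- The bimonad of a left-adjointable monoidal functor. -/
noncomputable abbrev bimonad (X : LMFunc.{v, u}) : Bmd.{v, u} :=
  have := X.base.hasLeftAdjoint
  letI := (ω X.base).oplaxMonoidal
  { base := Qobj ω X.base
    mon := X.monM
    oplax := (ω X.base).oplaxMonoidal
    comonμ := (ω X.base).isComonoidal_mul (ω X.base).isComonoidalAction_oplaxMonoidal
    comonη := (ω X.base).isComonoidal_one (ω X.base).isComonoidalAction_oplaxMonoidal }

/-- The bimonad morphism `⟨G, φ⟩` of a 1-cell `⟨F, κ, G⟩`. -/
noncomputable abbrev bimonadMap {X Y : LMFunc.{v, u}} (f : X ⟶ Y) : bimonad ω X ⟶ bimonad ω Y :=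
  { base := Qmap ω f.base
    lax := f.laxG
    ambi :=
      have := X.base.hasLeftAdjoint
      have := Y.base.hasLeftAdjoint
      letI := (ω X.base).oplaxMonoidal
      letI := (ω Y.base).oplaxMonoidal
      isAmbimonoidal_Qφ ω f (ω X.base).isComonoidalAction_oplaxMonoidal
        (ω Y.base).isComonoidalAction_oplaxMonoidal }

/-- A criterion for the whiskering axioms of a strict 2-functor into `Bmd`: up to the identifications
`p` and `q` of 1-cells, 2-cells agree if their components do. -/
theorem Bmd.eq_sandwich {X Y : Bmd.{v, u}} {f g f' g' : X ⟶ Y} (p : f = f') (q : g' = g)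
    {a : f ⟶ g} {b : f' ⟶ g'}
    (h : ∀ x, (Bmd.Hom₂.base a).ν.app x = eqToHom (by rw [p]) ≫ (Bmd.Hom₂.base b).ν.app x ≫
      eqToHom (by rw [q])) :
    a = eqToHom p ≫ b ≫ eqToHom q := by
  subst p q
  apply Bmd.hom₂_ext
  ext x
  simpa using h x

/-- The lift of `Q` to a 2-functor from left-adjointable monoidal functors to bimonads. -/
noncomputable def bimonadFunctor : StrictPseudofunctor LMFunc.{v, u} Bmd.{v, u} :=
  StrictPseudofunctor.mk''
    { obj := bimonad ω
      map := bimonadMap ω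
      map₂ := fun a => { base := Qmap₂ ω (LMFunc.Hom₂.base a), mon := LMFunc.Hom₂.monν a }
      map₂_id := fun _ => rfl
      map₂_comp := fun _ _ => rfl
      map_id := fun X => Bmd.hom_ext _ _ (Qmap_id ω X.base) rfl
      map_comp := fun f g =>
        Bmd.hom_ext _ _ (Qmap_comp ω (LMFunc.Hom.base f) (LMFunc.Hom.base g)) rfl
      map₂_whisker_left := fun _ _ _ _ =>
        Bmd.eq_sandwich _ _ fun _ => LMFunc.eq_sandwich rfl rfl rfl
      map₂_whisker_right := fun _ _ =>
        Bmd.eq_sandwich _ _ fun _ => LMFunc.eq_sandwich rfl rfl rfl }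

end lift

/-! ### Equality of strict 2-functors -/

section ext

variable {B C : Type*} [Bicategory B] [Bicategory C]

/-- A strict 2-functor is determined by its action on 0-cells, 1-cells and 2-cells. -/
theorem strictPseudofunctor_ext {F G : StrictPseudofunctor B C} (hobj : ∀ X, F.obj X = G.obj X)
    (hmap : ∀ {X Y : B} (f : X ⟶ Y), F.map f ≍ G.map f)
    (hmap₂ : ∀ {X Y : B} {f g : X ⟶ Y} (a : f ⟶ g), F.map₂ a ≍ G.map₂ a) : F = G := by
  obtain ⟨⟨⟨⟨⟨⟨Fobj, Fmap⟩, Fmap₂⟩, _, _⟩, FmapId, FmapComp, _, _, _, _, _⟩, _, hF⟩, _, hF'⟩ := F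
  obtain ⟨⟨⟨⟨⟨⟨Gobj, Gmap⟩, Gmap₂⟩, _, _⟩, GmapId, GmapComp, _, _, _, _, _⟩, _, hG⟩, _, hG'⟩ := G
  dsimp only at hobj hmap hmap₂ hF hF' hG hG'
  obtain rfl : Fobj = Gobj := funext hobj
  obtain rfl : @Fmap = @Gmap := by
    funext X Y f
    exact eq_of_heq (hmap f)
  obtain rfl : @Fmap₂ = @Gmap₂ := by
    funext X Y f g a
    exact eq_of_heq (hmap₂ a)
  obtain rfl : FmapId = GmapId := by
    funext X
    rw [hF, hG]
  obtain rfl : @FmapComp = @GmapComp := by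
    funext X Y Z f g
    rw [hF', hG']
  rfl

theorem heq_map_of_eq {F G : StrictPseudofunctor B C} (h : F = G) {X Y : B} (f : X ⟶ Y) :
    F.map f ≍ G.map f := by
  subst h; rfl

theorem heq_map₂_of_eq {F G : StrictPseudofunctor B C} (h : F = G) {X Y : B} {f g : X ⟶ Y}
    (a : f ⟶ g) : F.map₂ a ≍ G.map₂ a := by
  subst h; rfl

end ext

namespace Bmd

theorem hom_heq {X Y X' Y' : Bmd.{v, u}} (hX : X = X') (hY : Y = Y') {f : X ⟶ Y} {g : X' ⟶ Y'}
    (h : f.base ≍ g.base) (hG : laxHom f ≍ laxHom g) : f ≍ g := by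
  subst hX hY
  exact heq_of_eq (hom_ext f g (eq_of_heq h) (eq_of_heq hG))

theorem hom₂_heq {X Y X' Y' : Bmd.{v, u}} (hX : X = X') (hY : Y = Y') {f g : X ⟶ Y}
    {f' g' : X' ⟶ Y'} (hf : f ≍ f') (hg : g ≍ g') {a : f ⟶ g} {b : f' ⟶ g'}
    (h : a.base ≍ b.base) : a ≍ b := by
  subst hX hY hf hg
  exact heq_of_eq (hom₂_ext (eq_of_heq h))

/-- A bimonad whose underlying monad and monoidal category are given is given by a lax comonoidal
structure on that monad. -/
theorem exists_eq_mk (X : Bmd.{v, u}) (R : Mnd.{v, u}) [MonoidalCategory R.C] (h : X.base = R)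
    (h' : (LaxMonCat.mk X.base.C : LaxMonCat.{v, u}) = LaxMonCat.mk R.C) :
    ∃ (_ : R.T.toFunctor.OplaxMonoidal) (hμ : IsComonoidal R.T.μ) (hη : IsComonoidal R.T.η),
      X = Bmd.mk R hμ hη := by
  obtain ⟨X, hμ, hη⟩ := X
  dsimp only at h h'
  subst h
  simp only [LaxMonCat.mk.injEq, heq_eq_eq, true_and] at h'
  subst h'
  exact ⟨_, hμ, hη, rfl⟩

end Bmd

/-! ### Uniqueness of the lift -/

/-- The identity functor of the domain `A` of a monoidal functor `U : A ⥤ M`. -/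
abbrev idDom (X : LMFunc.{v, u}) : LMFunc.{v, u} where
  base := { A := X.base.A, M := X.base.A, U := 𝟭 X.base.A, hasLeftAdjoint := inferInstance }
  monA := X.monA
  monM := X.monA
  monU := inferInstanceAs (𝟭 X.base.A).Monoidal

/-- The 1-cell `⟨A, id, U⟩` from the identity functor of `A` to `U : A ⥤ M`. -/
abbrev fromIdDom (X : LMFunc.{v, u}) : idDom X ⟶ X :=
  { base := { F := 𝟭 X.base.A, G := X.base.U, κ := Iso.refl (𝟭 X.base.A ⋙ X.base.U) }
    laxF := inferInstanceAs (𝟭 X.base.A).LaxMonoidal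
    laxG := inferInstanceAs X.base.U.LaxMonoidal
    mon := inferInstanceAs (NatTrans.IsMonoidal (𝟙 (𝟭 X.base.A ⋙ X.base.U))) }

section identity

variable {A : Type u} [Category.{v} A] (ω : UniversalLeftAction (𝟭 A))

/-- A universal left action on an identity functor is invertible, with inverse the unit of its
monad. -/
theorem UniversalLeftAction.act_one (a : A) : ω.act.app a ≫ ω.one.app a = 𝟙 (ω.R.obj a) := by
  have h := ω.uniq_id (S := ω.R) (ω.act ≫ ω.one) (𝟙 _) fun a => by
    have := ω.one_act a
    dsimp only [Functor.id_obj] at this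
    simp [this]
  exact congrArg (fun t => t.app a) h

theorem UniversalLeftAction.isIso_one_app (a : A) : IsIso (ω.one.app a) :=
  ⟨ω.act.app a, ω.one_act a, ω.act_one a⟩

/-- For an identity functor `ω` is comonoidal, being inverse to the unit. The two components of this
fact are `δ_act` and `η_eq_act`. -/
theorem UniversalLeftAction.δ_act [MonoidalCategory A] [ω.R.OplaxMonoidal]
    (h : IsComonoidal ω.one) (a b : A) :
    δ ω.R a b ≫ (ω.act.app a ⊗ₘ ω.act.app b) = ω.act.app (a ⊗ b) := by
  have h1 (a : A) : ω.one.app a ≫ ω.act.app a = 𝟙 a := ω.one_act a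
  have := ω.isIso_one_app (a ⊗ b)
  have h3 := h.tensor a b
  rw [← cancel_epi (ω.one.app (a ⊗ b)), reassoc_of% h3]
  simp only [Functor.id_obj, id_δ, Category.id_comp, tensorHom_comp_tensorHom]
  erw [h1, h1, h1]
  simp

theorem UniversalLeftAction.η_eq_act [MonoidalCategory A] [ω.R.OplaxMonoidal]
    (h : IsComonoidal ω.one) : η ω.R = ω.act.app (𝟙_ A) := by
  have := ω.isIso_one_app (𝟙_ A)
  rw [← cancel_epi (ω.one.app (𝟙_ A)), h.counit]
  exact (ω.one_act (𝟙_ A)).symm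

end identity

section uniqueness

variable (ω : ∀ X : LFunc.{v, u}, UniversalLeftAction X.U)

/-- If `η` is comonoidal for the identity functor of `A` and the image of `⟨A, id, U⟩` under `Q` is
ambimonoidal, then the universal left action on `U` is compatible with the comonoidal structure:
the action on `U` is the image of `⟨A, id, U⟩` followed by `U` of the action on the identity. -/
theorem isComonoidalAction_of_isAmbimonoidal (X : LMFunc.{v, u})
    [(ω (idDom X).base).R.OplaxMonoidal] [(ω X.base).R.OplaxMonoidal]
    (hη : IsComonoidal (ω (idDom X).base).one)
    (h : IsAmbimonoidal (G := X.base.U) (H := X.base.U) (Qφ ω (fromIdDom X).base)) :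
    IsComonoidalAction (ω X.base).act := by
  have hω (a : X.base.A) : (ω X.base).act.app a =
      (Qφ ω (fromIdDom X).base).app a ≫ X.base.U.map ((ω (idDom X).base).act.app a) := by
    have := Qφ_spec ω (fromIdDom X).base a
    simpa using this
  constructor
  · intro a b
    have h2 := h.tensor a b
    have h3 := μ_natural X.base.U ((ω (idDom X).base).act.app a) ((ω (idDom X).base).act.app b)
    rw [hω, hω, hω, ← tensorHom_comp_tensorHom_assoc]
    erw [h3, reassoc_of% h2]
    rw [← Functor.map_comp]
    erw [(ω (idDom X).base).δ_act hη]
  · rw [h.unit, hω]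
    erw [(ω (idDom X).base).η_eq_act hη]

/-- The form of `isComonoidalAction_of_isAmbimonoidal` that applies to the values of an arbitrary lift:
`B₁` and `B₂` are only propositionally equal to bimonads on the prescribed monads. -/
theorem isComonoidalAction_of_hom (X : LMFunc.{v, u}) {B₁ B₂ : Bmd.{v, u}} (f : B₁ ⟶ B₂)
    (o₁ : (Qobj ω (idDom X).base).T.toFunctor.OplaxMonoidal)
    (o₂ : (Qobj ω X.base).T.toFunctor.OplaxMonoidal)
    (hμ₁ : IsComonoidal (Qobj ω (idDom X).base).T.μ)
    (hη₁ : IsComonoidal (Qobj ω (idDom X).base).T.η)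
    (hμ₂ : IsComonoidal (Qobj ω X.base).T.μ) (hη₂ : IsComonoidal (Qobj ω X.base).T.η)
    (h₁ : B₁ = Bmd.mk (Qobj ω (idDom X).base) hμ₁ hη₁) (h₂ : B₂ = Bmd.mk (Qobj ω X.base) hμ₂ hη₂)
    (hf : f.base ≍ Qmap ω (fromIdDom X).base)
    (hG : Bmd.laxHom f ≍ LMFunc.codHom (fromIdDom X)) :
    @IsComonoidalAction _ _ _ _ _ _ X.base.U (ω X.base).R _ o₂ (ω X.base).act := by
  subst h₁ h₂
  obtain ⟨f, lax, ambi⟩ := f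
  dsimp only at hf
  obtain rfl := eq_of_heq hf
  have h : lax = _ := eq_of_heq (LaxMonCat.Hom.mk.inj (eq_of_heq hG)).2
  subst h
  exact @isComonoidalAction_of_isAmbimonoidal ω X o₁ o₂ hη₁ ambi

theorem bimonadFunctor_comp_forget :
    (bimonadFunctor ω).comp Bmd.forget = LMFunc.forget.comp (Q ω) :=
  strictPseudofunctor_ext (fun _ => rfl) (fun _ => HEq.rfl) (fun _ => HEq.rfl)

theorem bimonadFunctor_comp_underlying :
    (bimonadFunctor ω).comp Bmd.underlying = LMFunc.cod :=
  strictPseudofunctor_ext (fun _ => rfl) (fun _ => HEq.rfl) (fun _ => HEq.rfl)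

/-- Both conditions together determine a lift on 1-cells and 2-cells; on 0-cells they leave only the
lax comonoidal structure free, which is fixed by the image of `⟨A, id, U⟩`. -/
theorem eq_bimonadFunctor (P : StrictPseudofunctor LMFunc.{v, u} Bmd.{v, u})
    (h : P.comp Bmd.forget = LMFunc.forget.comp (Q ω))
    (h' : P.comp Bmd.underlying = LMFunc.cod) : P = bimonadFunctor ω := by
  have hb (X) : (P.obj X).base = Qobj ω X.base := congrArg (fun F => F.obj X) h
  have hu (X) : (LaxMonCat.mk (P.obj X).base.C : LaxMonCat.{v, u}) = LaxMonCat.mk X.base.M :=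
    congrArg (fun F => F.obj X) h'
  have hobj (X) : P.obj X = bimonad ω X := by
    obtain ⟨o₁, hμ₁, hη₁, h₁⟩ := Bmd.exists_eq_mk _ (Qobj ω (idDom X).base) (hb (idDom X))
      (hu (idDom X))
    obtain ⟨o₂, hμ₂, hη₂, h₂⟩ := Bmd.exists_eq_mk _ (Qobj ω X.base) (hb X) (hu X)
    have key := isComonoidalAction_of_hom ω X (P.map (fromIdDom X)) o₁ o₂ hμ₁ hη₁ hμ₂ hη₂ h₁ h₂
      (heq_map_of_eq h (fromIdDom X)) (heq_map_of_eq h' (fromIdDom X))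
    have := X.base.hasLeftAdjoint
    have ho := (ω X.base).oplaxMonoidal_unique o₂ (ω X.base).oplaxMonoidal key
      (ω X.base).isComonoidalAction_oplaxMonoidal
    subst ho
    exact h₂
  have hmap {X Y : LMFunc.{v, u}} (f : X ⟶ Y) : P.map f ≍ (bimonadFunctor ω).map f :=
    Bmd.hom_heq (hobj X) (hobj Y) (heq_map_of_eq h f) (heq_map_of_eq h' f)
  exact strictPseudofunctor_ext hobj hmap fun {X Y f g} a =>
    Bmd.hom₂_heq (hobj X) (hobj Y) (hmap f) (hmap g) (heq_map₂_of_eq h a)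

end uniqueness

end SzBmd

/-- Let `Q : L-Func ⟶ Mnd` be the 2-functor given by a choice `ω` of a universal left action on
every left-adjointable functor. There is a unique 2-functor `L-MFunc ⟶ Bmd` that lifts `Q` through
the 2-functors forgetting the (co)monoidal structures and keeps the monoidal category `M` of an
object `U : A ⥤ M`, the lax monoidal functor `G` of a 1-cell `⟨F, κ, G⟩` and the monoidal
transformation `ν` of a 2-cell `[ϑ, ν]`. -/
theorem mainTheorem9 (ω : ∀ X : SzBmd.LFunc.{v, u}, SzBmd.UniversalLeftAction X.U) :
    ∃! QQ : StrictPseudofunctor SzBmd.LMFunc.{v, u} SzBmd.Bmd.{v, u},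
      QQ.comp SzBmd.Bmd.forget = SzBmd.LMFunc.forget.comp (SzBmd.Q ω) ∧
      QQ.comp SzBmd.Bmd.underlying = SzBmd.LMFunc.cod := by
  refine ⟨SzBmd.bimonadFunctor ω, ⟨SzBmd.bimonadFunctor_comp_forget ω,
    SzBmd.bimonadFunctor_comp_underlying ω⟩, fun P hP => SzBmd.eq_bimonadFunctor ω P hP.1 hP.2⟩
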